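/- A tract $F=(G,N_G)$ is an abelian group $G$ (written multiplicatively) with a subset $N_G$ of the group semiring $\mathbb N[G]$ such that $0\in N_G$, $1\notin N_G$, there is a unique $\epsilon\in G$ with $1+\epsilon\in N_G$, and $N_G$ is stable under multiplication by elements of $G$. Put $F=G\cup\{0\}\subset\mathbb N[G]$, $F^\times=G$, $-1:=\epsilon$ and $-x:=\epsilon x$. For $X\in F^E$ let $\underline X=\{e\in E: X(e)\neq 0\}$. Let $E$ be a non-empty finite set and $r$ a positive integer. A weak $F$-matroid on $E$ is given by a set $\mathcal C\subseteq F^E$ (its $F$-circuits) such that: (C0) $0\notin\mathcal C$; (C1) if $X\in\mathcal C$ and $\alpha\in F^\times$, then $\alpha X\in\mathcal C$; (C2) if $X,Y\in\mathcal C$ and $\underline X\subseteq\underline Y$, then $X=\alpha Y$ for some $\alpha\in F^\times$; (C3)$'$ if $X,Y\in\mathcal C$ have distinct supports such that $\underline X\cup\underline Y$ does not properly contain a union of two distinct supports of elements of $\mathcal C$, and $X(e)=-Y(e)\neq0$ for some $e \in E$, then there is $Z\in\mathcal C$ with $Z(e)=0$ and $X(f)+Y(f)-Z(f)\in N_G$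 for all $f\in E$. The supports of the elements of $\mathcal C$ are the circuits of a matroid on $E$, the underlying matroid; its rank is called the rank of the weak $F$-matroid. A weak Grassmann–Plücker function of rank $r$ on $E$ with coefficients in $F$ is a function $\varphi:E^r\to F$ such that: (GP1) $\varphi$ is not identically zero; (GP2) $\varphi(\dots,x_i,\dots,x_j,\dots)=-\varphi(\dots,x_j,\dots,x_i,\dots)$ for $i\ne j$, and $\varphi(x_1,\dots,x_r)=0$ if $x_i=x_j$ for some $i\neq j$; the sets $\{x_1,\dots,x_r\}$ with $\varphi(x_1,\dots,x_r)\neq0$ are the bases of a rank $r$ matroid $\underline M_\varphi$ on $E$; (GP3)$'$ for all subsets $I=\{x_1,\dots,x_{r+1}\}$ and $J=\{y_1,\dots,y_{r-1}\}$ of $E$, of sizes $r+1$ and $r-1$, with $|I\setminus J|=3$, $$\sum_{k=1}^{r+1}(-1)^k\varphi(x_1,\dots,\widehat{x_k},\dots,x_{r+1})\,\varphi(x_k,y_1,\dots,y_{r-1})\in N_G .$$ Two such functions are equivalent if $\varphi_1=g\varphi_2$ for some $g\in F^\times$. Let $\mathcal C_\varphi$ be the set of all $X\in F^E$ such that $\underline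 X$ is a circuit of $\underline M_\varphi$ and $$\frac{X(f)}{X(e)}=-\frac{\varphi(e,x_2,\dots,x_r)}{\varphi(f,x_2,\dots,x_r)}$$ for all $e,f\in E$ and every basis $\{f,x_2,\dots,x_r\}$ of $\underline M_\varphi$ containing $\underline X\setminus\{e\}$. Theorem. For every tract $F$, the map $\varphi\mapsto\mathcal C_\varphi$ induces a well-defined bijection from the set of equivalence classes of weak Grassmann–Plücker functions of rank $r$ on $E$ with coefficients in $F$ to the set of weak $F$-matroids of rank $r$ on $E$. Moreover, the underlying matroid of the weak $F$-matroid with $F$-circuit set $\mathcal C_\varphi$ is $\underline M_\varphi$. -/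

import Mathlib

/-- A tract `(G, N_G)`: an abelian group `G`, written multiplicatively, with an additive relation
structure `N_G ⊆ ℕ[G]`. -/
structure Tract (G : Type*) [CommGroup G] where
  /-- The null set `N_G`. -/
  null : Set (MonoidAlgebra ℕ G)
  zero_mem : (0 : MonoidAlgebra ℕ G) ∈ null
  one_notMem : (1 : MonoidAlgebra ℕ G) ∉ null
  existsUnique_neg : ∃! ε : G, 1 + MonoidAlgebra.of ℕ G ε ∈ null
  smul_mem : ∀ (g : G) (a : MonoidAlgebra ℕ G), a ∈ null → MonoidAlgebra.of ℕ G g * a ∈ null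

namespace Tract

variable {G : Type*} [CommGroup G]

/-- The inclusion of `F = G ∪ {0}`, modelled as `WithZero G`, in the group semiring `ℕ[G]`. -/
noncomputable def formal : WithZero G → MonoidAlgebra ℕ G :=
  WithZero.recZeroCoe 0 (fun g => MonoidAlgebra.of ℕ G g)

/-- The element `-1` of `F`, that is, the unique `ε ∈ G` with `1 + ε ∈ N_G`. -/
noncomputable def negOne (T : Tract G) : WithZero G :=
  (T.existsUnique_neg.choose : G)

/-- `-x = ε x`. -/
noncomputable def neg (T : Tract G) (x : WithZero G) : WithZero G :=
  T.negOne * x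

/-- The support of a vector in `F^E`. -/
def supp {E : Type*} (X : E → WithZero G) : Set E :=
  {e | X e ≠ 0}

end Tract

/-- Two members `A`, `B` of a family `S` of sets are a modular pair in `S` if they are distinct and
`A ∪ B` does not properly contain a union of two distinct members of `S`. -/
def IsModularPair {E : Type*} (S : Set (Set E)) (A B : Set E) : Prop :=
  A ∈ S ∧ B ∈ S ∧ A ≠ B ∧ ¬ ∃ A' ∈ S, ∃ B' ∈ S, A' ≠ B' ∧ A' ∪ B' ⊂ A ∪ B

/-- A weak `F`-matroid on `E`, given by its set of `F`-circuits. -/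
structure WeakMatroid {G : Type*} [CommGroup G] (T : Tract G) (E : Type*) where
  /-- The `F`-circuits. -/
  circuits : Set (E → WithZero G)
  /-- (C0) -/
  zero_notMem : 0 ∉ circuits
  /-- (C1) -/
  smul_mem : ∀ X ∈ circuits, ∀ α : G, (fun e => (α : WithZero G) * X e) ∈ circuits
  /-- (C2), incomparability -/
  incomparable : ∀ X ∈ circuits, ∀ Y ∈ circuits, Tract.supp X ⊆ Tract.supp Y →
    ∃ α : G, X = fun e => (α : WithZero G) * Y e
  /-- (C3)', modular elimination -/
  modular_elimination : ∀ X ∈ circuits, ∀ Y ∈ circuits,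
    IsModularPair (Tract.supp '' circuits) (Tract.supp X) (Tract.supp Y) →
    ∀ e : E, X e = T.neg (Y e) → X e ≠ 0 →
    ∃ Z ∈ circuits, Z e = 0 ∧ ∀ f : E,
      Tract.formal (X f) + Tract.formal (Y f) + Tract.formal (T.neg (Z f)) ∈ T.null

/-- A weak Grassmann–Plücker function of (positive) rank `d + 1` on `E` with coefficients in `F`. -/
structure WeakGPFunction {G : Type*} [CommGroup G] (T : Tract G) (E : Type*) (d : ℕ) where
  /-- The function `φ : E^(d+1) → F`. -/
  toFun : (Fin (d + 1) → E) → WithZero G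
  /-- The support of `φ` is the set of bases of a matroid of rank `d + 1` on `E`. -/
  exists_matroid : ∃ M : Matroid E, M.E = Set.univ ∧ M.eRank = ((d + 1 : ℕ) : ℕ∞) ∧
    ∀ B : Set E, M.IsBase B ↔ ∃ x : Fin (d + 1) → E, toFun x ≠ 0 ∧ Set.range x = B
  /-- (GP1) -/
  ne_zero : ∃ x, toFun x ≠ 0
  /-- (GP2), first half -/
  swap : ∀ (x : Fin (d + 1) → E) (i j : Fin (d + 1)), i ≠ j →
    toFun (x ∘ Equiv.swap i j) = T.neg (toFun x)
  /-- (GP2), second half -/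
  eq_zero : ∀ (x : Fin (d + 1) → E) (i j : Fin (d + 1)), i ≠ j → x i = x j → toFun x = 0
  /-- (GP3)', the 3-term Grassmann–Plücker relations; the index `k` here starts at `0` -/
  three_term : ∀ (x : Fin (d + 2) → E) (y : Fin d → E),
    Function.Injective x → Function.Injective y → (Set.range x \ Set.range y).ncard = 3 →
    ∑ k : Fin (d + 2), Tract.formal
      (T.negOne ^ ((k : ℕ) + 1) * toFun (x ∘ k.succAbove) * toFun (Fin.cons (x k) y)) ∈ T.null

namespace WeakGPFunction

variable {G : Type*} [CommGroup G] {T : Tract G} {E : Type*} {d : ℕ}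

/-- Equivalence of weak Grassmann–Plücker functions: `φ₁ = g · φ₂` for some `g ∈ F^×`. -/
instance setoid (T : Tract G) (E : Type*) (d : ℕ) : Setoid (WeakGPFunction T E d) where
  r φ₁ φ₂ := ∃ g : G, ∀ x, φ₁.toFun x = (g : WithZero G) * φ₂.toFun x
  iseqv := by
    refine ⟨fun φ => ⟨1, fun x => by simp⟩, ?_, ?_⟩
    · rintro φ₁ φ₂ ⟨g, hg⟩
      refine ⟨g⁻¹, fun x => ?_⟩
      rw [hg, ← mul_assoc, ← WithZero.coe_mul]
      simp
    · rintro φ₁ φ₂ φ₃ ⟨g, hg⟩ ⟨h, hh⟩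
      refine ⟨g * h, fun x => ?_⟩
      rw [hg, hh, ← mul_assoc, ← WithZero.coe_mul]

/-- The underlying matroid of `φ`: the matroid on `E` whose set of bases is the support of `φ`. -/
noncomputable def underlying (φ : WeakGPFunction T E d) : Matroid E :=
  φ.exists_matroid.choose

theorem underlying_ground (φ : WeakGPFunction T E d) : φ.underlying.E = Set.univ :=
  φ.exists_matroid.choose_spec.1

theorem underlying_isBase (φ : WeakGPFunction T E d) (B : Set E) :
    φ.underlying.IsBase B ↔ ∃ x : Fin (d + 1) → E, φ.toFun x ≠ 0 ∧ Set.range x = B :=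
  φ.exists_matroid.choose_spec.2.2 B

/-- The set `C_φ` of all `X ∈ F^E` whose support is a circuit of the underlying matroid and which
satisfy `X(f) / X(e) = - φ(e, x₂, …, x_r) / φ(f, x₂, …, x_r)` for all `e, f ∈ E` and every basis
`{f, x₂, …, x_r}` that contains `supp X \ e`. (Then `X(e) ≠ 0`, as a basis contains no circuit.) -/
def circuitSet (φ : WeakGPFunction T E d) : Set (E → WithZero G) :=
  {X | φ.underlying.IsCircuit (Tract.supp X) ∧
    ∀ (e f : E) (x : Fin d → E), φ.toFun (Fin.cons f x) ≠ 0 →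
      Tract.supp X \ {e} ⊆ Set.range (Fin.cons f x : Fin (d + 1) → E) →
      X f / X e = T.neg (φ.toFun (Fin.cons e x) / φ.toFun (Fin.cons f x))}

end WeakGPFunction

namespace WeakMatroid

variable {G : Type*} [CommGroup G] {T : Tract G} {E : Type*}

theorem formal_notMem_null (T : Tract G) {x : WithZero G} (hx : x ≠ 0) :
    Tract.formal x ∉ T.null := by
  obtain ⟨g, rfl⟩ := WithZero.ne_zero_iff_exists.1 hx
  intro h
  apply T.one_notMem
  have := T.smul_mem g⁻¹ _ h
  simpa [Tract.formal, MonoidAlgebra.one_def, MonoidAlgebra.single_mul_single] using this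

theorem negOne_ne_zero (T : Tract G) : T.negOne ≠ 0 := WithZero.coe_ne_zero

/-- The supports of the `F`-circuits satisfy circuit elimination for modular pairs. -/
theorem modular_supp_elimination (M : WeakMatroid T E) {A B : Set E}
    (h : IsModularPair (Tract.supp '' M.circuits) A B) {e : E} (heA : e ∈ A) (heB : e ∈ B) :
    ∃ C ∈ Tract.supp '' M.circuits, C ⊆ (A ∪ B) \ {e} := by
  obtain ⟨X, hX, rfl⟩ := h.1
  obtain ⟨Y, hY, rfl⟩ := h.2.1
  have hXe : X e ≠ 0 := heA
  have hYe : Y e ≠ 0 := heB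
  have hε := negOne_ne_zero T
  obtain ⟨α, hα⟩ := WithZero.ne_zero_iff_exists.1
    (mul_ne_zero (inv_ne_zero (mul_ne_zero hε hYe)) hXe)
  have hs : Tract.supp (fun f => (α : WithZero G) * Y f) = Tract.supp Y := by
    ext f; simp [Tract.supp]
  obtain ⟨Z, hZ, hZe, hZf⟩ := M.modular_elimination X hX _ (M.smul_mem Y hY α)
    (by rw [hs]; exact h) e (by
      simp only [Tract.neg]
      rw [hα, mul_left_comm, inv_mul_eq_div, div_mul_eq_mul_div, eq_div_iff (mul_ne_zero hε hYe)]) hXe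
  refine ⟨_, ⟨Z, hZ, rfl⟩, fun f hf => ?_⟩
  have hZf0 : Z f ≠ 0 := hf
  refine ⟨?_, ?_⟩
  · by_contra hc
    simp only [Set.mem_union, not_or, Tract.supp, Set.mem_ofPred_eq, not_not] at hc
    have := hZf f
    rw [hc.1, hc.2, mul_zero] at this
    have h0 : Tract.formal (0 : WithZero G) = 0 := rfl
    rw [h0, zero_add, zero_add] at this
    exact formal_notMem_null T (mul_ne_zero hε hZf0) this
  · rintro rfl
    exact hZf0 hZe

theorem supp_antichain (M : WeakMatroid T E) {A B : Set E} (hA : A ∈ Tract.supp '' M.circuits)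
    (hB : B ∈ Tract.supp '' M.circuits) (h : A ⊆ B) : A = B := by
  obtain ⟨X, hX, rfl⟩ := hA
  obtain ⟨Y, hY, rfl⟩ := hB
  obtain ⟨α, rfl⟩ := M.incomparable X hX Y hY h
  ext f; simp [Tract.supp]

/-- The supports of the `F`-circuits satisfy circuit elimination. -/
theorem supp_elimination [Finite E] (M : WeakMatroid T E) (n : ℕ) : ∀ {A B : Set E},
    (A ∪ B).ncard = n → A ∈ Tract.supp '' M.circuits → B ∈ Tract.supp '' M.circuits → A ≠ B →
    ∀ {e : E}, e ∈ A → e ∈ B → ∃ C ∈ Tract.supp '' M.circuits, C ⊆ (A ∪ B) \ {e} := by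
  induction n using Nat.strong_induction_on with
  | _ n ih =>
    intro A B hn hA hB hne e heA heB
    by_contra hcon
    by_cases hm : IsModularPair (Tract.supp '' M.circuits) A B
    · exact hcon (M.modular_supp_elimination hm heA heB)
    · have : ∃ A' ∈ Tract.supp '' M.circuits, ∃ B' ∈ Tract.supp '' M.circuits,
          A' ≠ B' ∧ A' ∪ B' ⊂ A ∪ B := by
        by_contra h
        exact hm ⟨hA, hB, hne, h⟩
      obtain ⟨A', hA', B', hB', hne', hss⟩ := this
      have hmem : ∀ C ∈ Tract.supp '' M.circuits, C ⊆ A ∪ B → e ∈ C := by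
        intro C hC hCs
        by_contra heC
        exact hcon ⟨C, hC, fun f hf => ⟨hCs hf, fun h => heC (h ▸ hf)⟩⟩
      obtain ⟨C, hC, hCs⟩ := ih _ (hn ▸ Set.ncard_lt_ncard hss (Set.toFinite _)) rfl hA' hB' hne'
        (hmem A' hA' (Set.subset_union_left.trans hss.subset))
        (hmem B' hB' (Set.subset_union_right.trans hss.subset))
      exact (hCs (hmem C hC ((hCs.trans Set.sdiff_subset).trans hss.subset))).2 rfl

/-- The augmentation property for the sets containing no support of an `F`-circuit. -/
theorem indep_aug [Finite E] (M : WeakMatroid T E) {I J : Set E}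
    (hI : ∀ X ∈ M.circuits, ¬ Tract.supp X ⊆ I) (hJ : ∀ X ∈ M.circuits, ¬ Tract.supp X ⊆ J)
    (hIJ : I.ncard < J.ncard) :
    ∃ e ∈ J, e ∉ I ∧ ∀ X ∈ M.circuits, ¬ Tract.supp X ⊆ insert e I := by
  by_contra! hcon
  let P : Set E → Prop := fun K =>
    K ⊆ I ∪ J ∧ I.ncard < K.ncard ∧ ∀ X ∈ M.circuits, ¬ Tract.supp X ⊆ K
  obtain ⟨K, ⟨hKs, hKc, hK⟩, hmin⟩ := exists_minimalFor_of_wellFoundedLT P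
    (fun K => (I \ K).ncard) ⟨J, Set.subset_union_right, hIJ, hJ⟩
  have hKI : (K \ I).Nonempty := by
    by_contra h
    rw [Set.not_nonempty_iff_eq_empty, Set.sdiff_eq_empty] at h
    exact absurd (Set.ncard_le_ncard h (Set.toFinite _)) (by omega)
  obtain ⟨e, heI, heK⟩ : ∃ e, e ∈ I ∧ e ∉ K := by
    by_contra! h
    obtain ⟨g, hgK, hgI⟩ := hKI
    obtain ⟨X, hX, hXs⟩ := hcon g ((hKs hgK).resolve_left hgI) hgI
    exact hK X hX (hXs.trans (Set.insert_subset hgK h))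
  have key : ∀ f ∈ K \ I, ∃ X ∈ M.circuits, Tract.supp X ⊆ insert e K ∧ f ∉ Tract.supp X ∧
      e ∈ Tract.supp X := by
    intro f hf
    have hne : e ≠ f := fun h => heK (h ▸ hf.1)
    by_contra! hc
    have hP : P (insert e (K \ {f})) := by
      refine ⟨?_, ?_, ?_⟩
      · exact Set.insert_subset (Or.inl heI) (Set.sdiff_subset.trans hKs)
      · rw [Set.ncard_exchange heK hf.1]
        exact hKc
      · intro X hX hXs
        have h1 : f ∉ Tract.supp X := fun h => by
          rcases hXs h with h | h
          · exact hne h.symm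
          · exact h.2 rfl
        have h2 := hc X hX (hXs.trans (Set.insert_subset_insert Set.sdiff_subset)) h1
        exact hK X hX fun g hg => by
          rcases hXs hg with h | h
          · exact absurd (h ▸ hg) h2
          · exact h.1
    have hlt : (I \ insert e (K \ {f})).ncard < (I \ K).ncard := by
      apply Set.ncard_lt_ncard _ (Set.toFinite _)
      refine ⟨fun g hg => ⟨hg.1, fun hgK => hg.2 (Or.inr ⟨hgK, ?_⟩)⟩, fun h => ?_⟩
      · rintro rfl; exact hf.2 hg.1
      · exact (h ⟨heI, heK⟩).2 (Or.inl rfl)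
    exact absurd (hmin hP hlt.le) (by simpa using hlt)
  obtain ⟨g, hg⟩ := hKI
  obtain ⟨X, hX, hXs, hgX, heX⟩ := key g hg
  obtain ⟨h, hhX, hhK⟩ : ∃ h ∈ Tract.supp X, h ∈ K \ I := by
    by_contra! hc
    refine hI X hX fun a ha => ?_
    rcases hXs ha with rfl | haK
    · exact heI
    · by_contra haI
      exact hc a ha ⟨haK, haI⟩
  obtain ⟨Y, hY, hYs, hhY, heY⟩ := key h hhK
  obtain ⟨_, ⟨Z, hZ, rfl⟩, hZs⟩ := M.supp_elimination _ rfl ⟨X, hX, rfl⟩ ⟨Y, hY, rfl⟩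
    (fun hXY => hhY (hXY ▸ hhX)) heX heY
  refine hK Z hZ fun a ha => ?_
  obtain ⟨h1, h2⟩ := hZs ha
  exact (Set.union_subset hXs hYs h1).resolve_left h2

/-- The underlying matroid of a weak `F`-matroid: the matroid on `E` whose circuits are the
supports of the `F`-circuits (see `underlying_isCircuit`). -/
def underlying [Finite E] (M : WeakMatroid T E) : Matroid E :=
  (IndepMatroid.ofFinite (Set.finite_univ (α := E))
    (fun I => ∀ X ∈ M.circuits, ¬ Tract.supp X ⊆ I)
    (by
      intro X hX h
      apply M.zero_notMem
      have : X = 0 := by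
        funext e
        by_contra he
        exact h (show e ∈ Tract.supp X from he)
      exact this ▸ hX)
    (fun _ _ hJ hIJ X hX h => hJ X hX (h.trans hIJ))
    (fun _ _ hI hJ h => M.indep_aug hI hJ h)
    (fun _ _ => Set.subset_univ _)).matroid

theorem underlying_ground [Finite E] (M : WeakMatroid T E) : M.underlying.E = Set.univ := rfl

theorem underlying_isCircuit [Finite E] (M : WeakMatroid T E) (C : Set E) :
    M.underlying.IsCircuit C ↔ C ∈ Tract.supp '' M.circuits := by
  have hdep : ∀ D : Set E, ¬ M.underlying.Indep D ↔ ∃ X ∈ M.circuits, Tract.supp X ⊆ D := by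
    intro D
    change ¬ (∀ X ∈ M.circuits, ¬ Tract.supp X ⊆ D) ↔ _
    push Not
    rfl
  rw [Matroid.isCircuit_iff_minimal_not_indep (Set.subset_univ C)]
  constructor
  · rintro ⟨h1, h2⟩
    obtain ⟨X, hX, hXC⟩ := (hdep C).1 h1
    exact ⟨X, hX, hXC.antisymm (h2 ((hdep _).2 ⟨X, hX, subset_rfl⟩) hXC)⟩
  · rintro ⟨X, hX, rfl⟩
    refine ⟨(hdep _).2 ⟨X, hX, subset_rfl⟩, fun D hD hDX => ?_⟩
    obtain ⟨Y, hY, hYD⟩ := (hdep D).1 hD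
    rw [← M.supp_antichain ⟨Y, hY, rfl⟩ ⟨X, hX, rfl⟩ (hYD.trans hDX)]
    exact hYD

/-- The rank of a weak `F`-matroid is the rank of its underlying matroid. -/
noncomputable def rank [Finite E] (M : WeakMatroid T E) : ℕ∞ :=
  M.underlying.eRank

end WeakMatroid

-- A Grassmann–Plücker function `φ` and its `F`-circuits `X` are tied together by one relation: if
-- the support of `X` lies in `{e, e'} ∪ S`, then `X(e) φ(e, S) = -X(e') φ(e', S)`
-- (`CircuitRelation`). Given `φ`, it fixes `X` on a circuit up to a scalar (`exists_eq_mul`). Given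
-- the circuits, it fixes the ratio of `φ` on adjacent bases, hence `φ` up to a scalar, because
-- bases are connected by exchanges (`isBase_induction`, `equiv_of_circuitSet_eq`). What remains is
-- existence in both directions.
--
-- From `φ` to circuits: a formula as in Cramer's rule gives a vector on each circuit, and
-- three-term relations with one vanishing product show that the choice of `S` is immaterial
-- (`circuitRelation_transfer`, `exists_mem_circuitSet`). Modular elimination is, coordinate by
-- coordinate, equivalent to a three-term relation (`elimination_iff_threeTerm`).
--
-- From circuits to `φ`: fix an alternating sign function `s` and look for `φ = s ψ` with `ψ` a
-- function of bases. The circuits prescribe every ratio `ψ(S + e) / ψ(S + f)`, and the question is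
-- whether these ratios are consistent around all closed paths of exchanges. It suffices to check
-- three local configurations (`LocalPotential`): three bases containing a common `S` of corank one,
-- triangles inside some `S + a + b + c`, and squares without diagonals. This is a homotopy theorem
-- for the basis graph, proved by deleting and contracting one element at a time
-- (`exists_potential_aux`). The first condition follows from modular elimination; a triangle is
-- governed by one circuit, a square by two. The three-term relations for `φ` then come from reading
-- `elimination_iff_threeTerm` backwards, with degenerate cases governed by a single circuit
-- (`mul_eq_mul_of_eq_zero`).

local infixr:67 " ∷ " => Fin.cons (α := fun _ => _)

/-! ### Tuples, their ranges and reorderings. -/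

section Tuples

variable {E : Type*} {n : ℕ}

theorem range_cons_eq_insert (e : E) (x : Fin n → E) :
    Set.range (e ∷ x : Fin (n + 1) → E) = insert e (Set.range x) := Fin.range_cons e x

theorem exists_perm_of_range_eq {x y : Fin n → E} (hx : x.Injective) (hy : y.Injective)
    (h : Set.range x = Set.range y) : ∃ σ : Equiv.Perm (Fin n), y = x ∘ σ := by
  refine ⟨(Equiv.ofInjective y hy).trans ((Equiv.setCongr h.symm).trans
    (Equiv.ofInjective x hx).symm), funext fun i => ?_⟩
  have := Equiv.apply_ofInjective_symm hx (Equiv.setCongr h.symm (Equiv.ofInjective y hy i))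
  simpa using this.symm

theorem exists_injective_range_eq [Finite E] {S : Set E} (h : S.ncard = n) :
    ∃ x : Fin n → E, x.Injective ∧ Set.range x = S := by
  have : Nat.card S = n := h
  let e := (Finite.equivFinOfCardEq this).symm
  refine ⟨fun i => (e i : E), Subtype.val_injective.comp e.injective, ?_⟩
  ext a
  constructor
  · rintro ⟨i, rfl⟩; exact (e i).2
  · intro ha; exact ⟨e.symm ⟨a, ha⟩, by simp⟩

theorem ncard_range_of_injective {x : Fin n → E} (hx : x.Injective) :
    (Set.range x).ncard = n := by
  rw [← Set.image_univ, Set.ncard_image_of_injective _ hx, Set.ncard_univ, Nat.card_fin]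

theorem injective_of_ncard_range {x : Fin n → E} (hx : (Set.range x).ncard = n) :
    x.Injective := by
  rw [← Set.image_univ] at hx
  have := Set.injOn_of_ncard_image_eq (f := x) (s := Set.univ) (by rw [hx, Set.ncard_univ, Nat.card_fin])
  exact fun a b h => this (Set.mem_univ a) (Set.mem_univ b) h

theorem injective_cons_iff {e : E} {x : Fin n → E} :
    (e ∷ x : Fin (n + 1) → E).Injective ↔ e ∉ Set.range x ∧ x.Injective :=
  Fin.cons_injective_iff

theorem cons_comp_perm (e : E) (x : Fin n → E) (τ : Equiv.Perm (Fin n)) :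
    (e ∷ (x ∘ τ) : Fin (n + 1) → E) =
      (e ∷ x : Fin (n + 1) → E) ∘ Equiv.Perm.decomposeFin.symm (0, τ) := by
  funext i
  refine Fin.cases ?_ (fun j => ?_) i <;> simp

theorem cons_cons_comp_swap (a b : E) (x : Fin n → E) :
    (b ∷ a ∷ x : Fin (n + 2) → E) = (a ∷ b ∷ x : Fin (n + 2) → E) ∘ Equiv.swap 0 1 := by
  funext i
  refine Fin.cases ?_ (fun j => Fin.cases ?_ (fun k => ?_) j) i
  · simp
  · simp
  · rw [Function.comp_apply, Equiv.swap_apply_of_ne_of_ne (Fin.succ_ne_zero _)]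
    · rfl
    · simp [Fin.ext_iff]

theorem cons_cons_comp_succAbove_one (a b : E) (x : Fin n → E) :
    (a ∷ b ∷ x : Fin (n + 2) → E) ∘ Fin.succAbove 1 = a ∷ x := by
  funext i
  refine Fin.cases ?_ (fun j => ?_) i
  · simp
  · rw [Function.comp_apply, ← Fin.succ_zero_eq_one, Fin.succ_succAbove_succ]
    simp

theorem cons_comp_succAbove_succ (a : E) (x : Fin (n + 1) → E) (i : Fin (n + 1)) :
    (a ∷ x : Fin (n + 2) → E) ∘ i.succ.succAbove = a ∷ (x ∘ i.succAbove) := by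
  funext j
  refine Fin.cases ?_ (fun j => ?_) j
  · simp
  · simp

end Tuples

/-! ### Arithmetic of signs in a tract, and alternating functions. -/

namespace Tract

variable {G : Type*} [CommGroup G] {E : Type*} {n : ℕ} (T : Tract G)

@[simp] theorem formal_zero : formal (0 : WithZero G) = 0 := rfl

theorem formal_coe (g : G) : formal (g : WithZero G) = MonoidAlgebra.of ℕ G g := rfl

theorem formal_coe_mul (g : G) (x : WithZero G) :
    formal ((g : WithZero G) * x) = MonoidAlgebra.of ℕ G g * formal x := by
  induction x using WithZero.recZeroCoe with
  | zero => simp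
  | coe h => rw [← WithZero.coe_mul, formal_coe, formal_coe, map_mul]

theorem of_mul_mem_null_iff (g : G) (a : MonoidAlgebra ℕ G) :
    MonoidAlgebra.of ℕ G g * a ∈ T.null ↔ a ∈ T.null := by
  refine ⟨fun h => ?_, T.smul_mem g a⟩
  have := T.smul_mem g⁻¹ _ h
  rwa [← mul_assoc, ← map_mul, inv_mul_cancel, map_one, one_mul] at this

theorem negOne_ne_zero : T.negOne ≠ 0 := WithZero.coe_ne_zero

theorem one_add_negOne : formal 1 + formal T.negOne ∈ T.null :=
  T.existsUnique_neg.choose_spec.1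

theorem eq_negOne {x : WithZero G} (h : formal 1 + formal x ∈ T.null) : x = T.negOne := by
  induction x using WithZero.recZeroCoe with
  | zero => exact absurd (by simpa [formal, ← MonoidAlgebra.one_def] using h) T.one_notMem
  | coe g => exact congrArg _ (T.existsUnique_neg.choose_spec.2 g h)

/-- Multiplying the null element `1 + ε` by `ε⁻¹` gives `ε⁻¹ + 1`, so `ε⁻¹ = ε` by uniqueness. -/
theorem negOne_mul_negOne : T.negOne * T.negOne = 1 := by
  obtain ⟨g, hg⟩ := WithZero.ne_zero_iff_exists.1 T.negOne_ne_zero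
  have h := T.one_add_negOne
  rw [← hg] at h ⊢
  have h2 := T.smul_mem g⁻¹ _ h
  rw [mul_add, ← formal_coe_mul, ← formal_coe_mul, mul_one, ← WithZero.coe_mul, inv_mul_cancel,
    add_comm] at h2
  have h3 := T.eq_negOne h2
  rw [← hg, WithZero.coe_inj] at h3
  nth_rewrite 1 [← h3]
  rw [← WithZero.coe_mul, inv_mul_cancel]; rfl

theorem negOne_mul_cancel_left (x : WithZero G) : T.negOne * (T.negOne * x) = x := by
  rw [← mul_assoc, negOne_mul_negOne, one_mul]

theorem eq_negOne_mul_comm {x y : WithZero G} : x = T.negOne * y ↔ y = T.negOne * x := by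
  constructor <;> rintro rfl <;> rw [negOne_mul_cancel_left]

theorem formal_add_mem_null_iff {x y : WithZero G} :
    formal x + formal y ∈ T.null ↔ y = T.negOne * x := by
  induction x using WithZero.recZeroCoe with
  | zero =>
    simp only [formal_zero, zero_add, mul_zero]
    constructor
    · intro h
      by_contra hy
      exact WeakMatroid.formal_notMem_null T hy h
    · rintro rfl; exact T.zero_mem
  | coe g =>
    have h1 : (g : WithZero G) * 1 = g := mul_one _
    have h2 : (g : WithZero G) * ((g⁻¹ : G) * y) = y := by
      rw [← mul_assoc, ← WithZero.coe_mul, mul_inv_cancel]; exact one_mul _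
    rw [← h2]
    nth_rewrite 1 [← h1]
    rw [formal_coe_mul, formal_coe_mul, ← mul_add, of_mul_mem_null_iff, mul_comm T.negOne]
    constructor
    · intro h; rw [T.eq_negOne h]
    · intro h
      rw [mul_right_injective₀ WithZero.coe_ne_zero h]
      exact T.one_add_negOne

/-- Three-term sums may be rescaled by a non-zero factor. -/
theorem formal_mul_add_mem_null_iff {u : WithZero G} (hu : u ≠ 0) (x y z : WithZero G) :
    formal (u * x) + formal (u * y) + formal (u * z) ∈ T.null ↔
      formal x + formal y + formal z ∈ T.null := by
  obtain ⟨g, rfl⟩ := WithZero.ne_zero_iff_exists.1 hu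
  rw [formal_coe_mul, formal_coe_mul, formal_coe_mul, ← mul_add, ← mul_add, of_mul_mem_null_iff]

/-- The sign character `{±1} → F^×`. -/
noncomputable def signHom : ℤˣ →* WithZero G where
  toFun u := if u = 1 then 1 else T.negOne
  map_one' := by simp
  map_mul' u v := by
    rcases Int.units_eq_one_or u with rfl | rfl <;> rcases Int.units_eq_one_or v with rfl | rfl <;>
      simp [negOne_mul_negOne]

theorem signHom_neg_one : T.signHom (-1) = T.negOne := by simp [signHom]

theorem signHom_ne_zero (u : ℤˣ) : T.signHom u ≠ 0 := by
  rcases Int.units_eq_one_or u with rfl | rfl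
  · simp
  · rw [signHom_neg_one]; exact T.negOne_ne_zero

theorem signHom_mul_self (u : ℤˣ) : T.signHom u * T.signHom u = 1 := by
  rw [← map_mul, Int.units_mul_self, map_one]

/-- Alternating functions on tuples with values in a tract. -/
structure IsAlternating (f : (Fin n → E) → WithZero G) : Prop where
  swap : ∀ (x : Fin n → E) (i j : Fin n), i ≠ j → f (x ∘ Equiv.swap i j) = T.negOne * f x
  eq_zero : ∀ x : Fin n → E, ¬ x.Injective → f x = 0

namespace IsAlternating

variable {T} {f : (Fin n → E) → WithZero G}

theorem comp_perm (hf : T.IsAlternating f) (x : Fin n → E) (σ : Equiv.Perm (Fin n)) :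
    f (x ∘ σ) = T.signHom σ.sign * f x := by
  induction σ using Equiv.Perm.swap_induction_on' with
  | one => simp
  | mul_swap σ i j hij ih =>
    rw [Equiv.Perm.coe_mul, ← Function.comp_assoc, hf.swap _ _ _ hij, ih, Equiv.Perm.sign_mul,
      map_mul, Equiv.Perm.sign_swap hij, signHom_neg_one, mul_left_comm, mul_assoc]

variable {f : (Fin (n + 1) → E) → WithZero G}

theorem cons_comp_perm (hf : T.IsAlternating f) (e : E) (x : Fin n → E) (τ : Equiv.Perm (Fin n)) :
    f (e ∷ (x ∘ τ)) = T.signHom τ.sign * f (e ∷ x) := by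
  rw [_root_.cons_comp_perm, hf.comp_perm, Equiv.Perm.decomposeFin.symm_sign, if_pos rfl, one_mul]

/-- Signed maximal minors transform by the sign of a reordering. Moving position `k` to the front
before `σ`, and position `σ k` to the front after it, turns `σ` into a permutation `ρ` fixing `0`;
its restriction `τ` to the other positions has the sign of `σ` corrected by the two cycles. -/
theorem signed_succAbove (hf : T.IsAlternating f) (x : Fin (n + 2) → E)
    (σ : Equiv.Perm (Fin (n + 2))) (k : Fin (n + 2)) :
    T.negOne ^ (k : ℕ) * f (x ∘ σ ∘ k.succAbove) =
      T.signHom σ.sign * (T.negOne ^ ((σ k : Fin (n + 2)) : ℕ) * f (x ∘ (σ k).succAbove)) := by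
  set ρ : Equiv.Perm (Fin (n + 2)) := (k.cycleRange.symm.trans σ).trans (σ k).cycleRange with hρ
  obtain ⟨⟨p, τ⟩, hτ⟩ := Equiv.Perm.decomposeFin.symm.surjective ρ
  have h0 : ρ 0 = 0 := by simp [hρ]
  have hp : p = 0 := by rw [← h0, ← hτ, Equiv.Perm.decomposeFin_symm_apply_zero]
  subst hp
  have hs : τ.sign = ρ.sign := by
    rw [← hτ, Equiv.Perm.decomposeFin.symm_sign, if_pos rfl, one_mul]
  have hsucc : ∀ i : Fin (n + 1), ρ i.succ = (τ i).succ := by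
    intro i; rw [← hτ]; simp
  have hx : x ∘ σ ∘ k.succAbove = (x ∘ (σ k).succAbove) ∘ τ := by
    funext i
    have h1 := hsucc i
    simp only [hρ, Equiv.trans_apply, Fin.cycleRange_symm_succ] at h1
    have h2 := congrArg (σ k).cycleRange.symm h1
    rw [Equiv.symm_apply_apply, Fin.cycleRange_symm_succ] at h2
    simp [h2]
  rw [hx, hf.comp_perm, hs, hρ, Equiv.Perm.sign_trans, Equiv.Perm.sign_trans, Equiv.Perm.sign_symm,
    Fin.sign_cycleRange, Fin.sign_cycleRange, map_mul, map_mul, map_pow, map_pow, signHom_neg_one]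
  have : T.negOne ^ (k : ℕ) * T.negOne ^ (k : ℕ) = 1 := by
    rw [← mul_pow, negOne_mul_negOne, one_pow]
  generalize T.negOne ^ (k : ℕ) = p at this
  generalize T.negOne ^ ((σ k : Fin (n + 2)) : ℕ) = q
  calc p * (q * (T.signHom σ.sign * p) * f (x ∘ (σ k).succAbove))
      = (p * p) * (T.signHom σ.sign * (q * f (x ∘ (σ k).succAbove))) := by
        simp only [mul_comm, mul_left_comm, mul_assoc]
    _ = _ := by rw [this, one_mul]

end IsAlternating

end Tract

/-! ### Grassmann–Plücker relations reduced to a three-term normal form. -/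

namespace Tract

variable {G : Type*} [CommGroup G] {E : Type*} {n : ℕ} (T : Tract G)

/-- The left-hand side of a Grassmann–Plücker relation. -/
noncomputable def pluckerSum (f : (Fin (n + 1) → E) → WithZero G) (x : Fin (n + 2) → E)
    (y : Fin n → E) : MonoidAlgebra ℕ G :=
  ∑ k : Fin (n + 2), formal (T.negOne ^ ((k : ℕ) + 1) * f (x ∘ k.succAbove) * f (x k ∷ y))

/-- The three-term Grassmann–Plücker relation in normal form. -/
def ThreeTerm (f : (Fin (n + 2) → E) → WithZero G) (S : Fin n → E) (a b c e : E) : Prop :=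
  formal (f (a ∷ b ∷ S) * f (c ∷ e ∷ S)) + formal (T.negOne * (f (a ∷ c ∷ S) * f (b ∷ e ∷ S))) +
    formal (f (b ∷ c ∷ S) * f (a ∷ e ∷ S)) ∈ T.null

namespace IsAlternating

variable {T}

/-- Reordering both tuples permutes the summands and multiplies all of them by `sign σ * sign τ`, so
only the two underlying sets matter. -/
theorem pluckerSum_comp {f : (Fin (n + 1) → E) → WithZero G} (hf : T.IsAlternating f)
    (x : Fin (n + 2) → E) (y : Fin n → E) (σ : Equiv.Perm (Fin (n + 2)))
    (τ : Equiv.Perm (Fin n)) :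
    T.pluckerSum f (x ∘ σ) (y ∘ τ) ∈ T.null ↔ T.pluckerSum f x y ∈ T.null := by
  obtain ⟨g, hg⟩ := WithZero.ne_zero_iff_exists.1 (T.signHom_ne_zero (σ.sign * τ.sign))
  suffices h : T.pluckerSum f (x ∘ σ) (y ∘ τ) = MonoidAlgebra.of ℕ G g * T.pluckerSum f x y by
    rw [h, of_mul_mem_null_iff]
  rw [pluckerSum, pluckerSum, Finset.mul_sum]
  refine Fintype.sum_equiv σ _ _ fun k => ?_
  rw [← formal_coe_mul, hg, map_mul, pow_succ', pow_succ', mul_assoc T.negOne, Function.comp_assoc,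
    hf.signed_succAbove, hf.cons_comp_perm]
  congr 1
  simp only [Function.comp_apply, mul_assoc, mul_left_comm]

theorem cons_swap {f : (Fin (n + 2) → E) → WithZero G} (hf : T.IsAlternating f)
    (a b : E) (S : Fin n → E) : f (b ∷ a ∷ S) = T.negOne * f (a ∷ b ∷ S) := by
  rw [cons_cons_comp_swap, hf.swap _ _ _ (by simp)]

theorem cons_eq_zero {f : (Fin (n + 1) → E) → WithZero G} (hf : T.IsAlternating f)
    {a : E} {S : Fin n → E} (h : a ∈ Set.range S) : f (a ∷ S) = 0 :=
  hf.eq_zero _ fun hi => (injective_cons_iff.1 hi).1 h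

variable {f : (Fin (n + 2) → E) → WithZero G}

theorem cons_self (hf : T.IsAlternating f) (a : E) (S : Fin n → E) : f (a ∷ a ∷ S) = 0 :=
  hf.cons_eq_zero ⟨0, rfl⟩

theorem threeTerm_swap_left (hf : T.IsAlternating f) {S : Fin n → E} {a b c e : E}
    (h : T.ThreeTerm f S a b c e) : T.ThreeTerm f S b a c e := by
  rw [ThreeTerm] at h ⊢
  rw [← T.formal_mul_add_mem_null_iff T.negOne_ne_zero, negOne_mul_cancel_left] at h
  rw [hf.cons_swap a b, mul_assoc]
  convert h using 1
  abel

theorem threeTerm_swap_middle (hf : T.IsAlternating f) {S : Fin n → E} {a b c e : E}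
    (h : T.ThreeTerm f S a b c e) : T.ThreeTerm f S a c b e := by
  rw [ThreeTerm] at h ⊢
  rw [← T.formal_mul_add_mem_null_iff T.negOne_ne_zero, negOne_mul_cancel_left] at h
  rw [hf.cons_swap b c, mul_assoc]
  convert h using 1
  abel

theorem threeTerm_swap_right (hf : T.IsAlternating f) {S : Fin n → E} {a b c e : E}
    (h : T.ThreeTerm f S a b c e) : T.ThreeTerm f S a b e c := by
  rw [ThreeTerm] at h ⊢
  rw [← T.formal_mul_add_mem_null_iff T.negOne_ne_zero, negOne_mul_cancel_left] at h
  rw [hf.cons_swap c e, mul_left_comm]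
  convert h using 1
  rw [mul_comm (f (a ∷ e ∷ S)), mul_comm (f (b ∷ e ∷ S))]
  abel

theorem threeTerm_self_left (hf : T.IsAlternating f) (S : Fin n → E) (a c e : E) :
    T.ThreeTerm f S a a c e := by
  rw [ThreeTerm, hf.cons_self, zero_mul, formal_zero, zero_add, add_comm,
    formal_add_mem_null_iff]

/-- Two equal letters kill one product and make the other two opposite; the swaps reduce everything
to `a = b`. -/
theorem threeTerm_of_eq (hf : T.IsAlternating f) {S : Fin n → E} {a b c e : E}
    (h : a = b ∨ a = c ∨ a = e ∨ b = c ∨ b = e ∨ c = e) : T.ThreeTerm f S a b c e := by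
  rcases h with rfl | rfl | rfl | rfl | rfl | rfl
  · exact hf.threeTerm_self_left S a c e
  · exact hf.threeTerm_swap_middle (hf.threeTerm_self_left S a b e)
  · exact hf.threeTerm_swap_right (hf.threeTerm_swap_middle (hf.threeTerm_self_left S a b c))
  · exact hf.threeTerm_swap_left (hf.threeTerm_swap_middle
      (hf.threeTerm_swap_left (hf.threeTerm_swap_left (hf.threeTerm_self_left S b a e))))
  · exact hf.threeTerm_swap_left (hf.threeTerm_swap_right
      (hf.threeTerm_swap_middle (hf.threeTerm_self_left S b a c)))
  · exact hf.threeTerm_swap_middle (hf.threeTerm_swap_left (hf.threeTerm_swap_right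
      (hf.threeTerm_swap_middle (hf.threeTerm_self_left S c a b))))

/-- Every summand whose distinguished element lies in `S` repeats that element in its second factor,
so only those of `a`, `b` and `c` survive. -/
theorem pluckerSum_cons (hf : T.IsAlternating f) (S : Fin n → E) (a b c e : E) :
    T.pluckerSum f (a ∷ b ∷ c ∷ S) (e ∷ S) ∈ T.null ↔ T.ThreeTerm f S a b c e := by
  rw [ThreeTerm, ← T.formal_mul_add_mem_null_iff T.negOne_ne_zero, pluckerSum,
    Fin.sum_univ_succ, Fin.sum_univ_succ, Fin.sum_univ_succ, Finset.sum_eq_zero]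
  · rw [cons_comp_succAbove_succ, cons_comp_succAbove_succ, cons_comp_succAbove_succ]
    have h2 : (c ∷ S : Fin (n + 1) → E) ∘ Fin.succAbove 0 = S := by funext i; simp
    have h1 : (b ∷ c ∷ S : Fin (n + 2) → E) ∘ Fin.succAbove 0 = c ∷ S := by funext i; simp
    have h0 : (a ∷ b ∷ c ∷ S : Fin (n + 3) → E) ∘ Fin.succAbove 0 = b ∷ c ∷ S := by
      funext i; simp
    rw [h0, h1, h2]
    have hε : T.negOne ^ 3 = T.negOne := by rw [pow_succ, pow_two, negOne_mul_negOne, one_mul]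
    have hε2 : T.negOne ^ 2 = 1 := by rw [pow_two, negOne_mul_negOne]
    simp only [Fin.val_zero, zero_add, pow_one, Fin.val_succ, Nat.reduceAdd, hε, hε2, one_mul,
      Fin.cons_zero, Fin.cons_succ, add_zero, negOne_mul_cancel_left, mul_assoc]
    rw [← add_assoc, add_comm, ← add_assoc, add_right_comm]
  · intro i _
    have : f (S i ∷ e ∷ S) = 0 := hf.cons_eq_zero ⟨i.succ, by simp⟩
    simp [this]

theorem pluckerSum_mem_null (hf : T.IsAlternating f)
    (h : ∀ (S : Fin n → E) (a b c e : E), T.ThreeTerm f S a b c e)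
    {x : Fin (n + 3) → E} {y : Fin (n + 1) → E} [Finite E]
    (hx : x.Injective) (hy : y.Injective) (hxy : (Set.range x \ Set.range y).ncard = 3) :
    T.pluckerSum f x y ∈ T.null := by
  have hcx := ncard_range_of_injective hx
  have hcy := ncard_range_of_injective hy
  have h1 := Set.ncard_inter_add_ncard_sdiff_eq_ncard (Set.range x) (Set.range y)
  have h2 := Set.ncard_inter_add_ncard_sdiff_eq_ncard (Set.range y) (Set.range x)
  rw [Set.inter_comm] at h2
  obtain ⟨S, hS, hSr⟩ := exists_injective_range_eq
    (show (Set.range x ∩ Set.range y).ncard = n by omega)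
  obtain ⟨a, b, c, hab, hac, hbc, habc⟩ := Set.ncard_eq_three.1 hxy
  obtain ⟨e, he⟩ := Set.ncard_eq_one.1 (show (Set.range y \ Set.range x).ncard = 1 by omega)
  have hx' : Set.range (a ∷ b ∷ c ∷ S : Fin (n + 3) → E) = Set.range x := by
    have h3 : {a, b, c} ∪ Set.range x ∩ Set.range y = Set.range x := by
      rw [← habc, Set.sdiff_union_inter]
    simpa only [range_cons_eq_insert, hSr, Set.insert_union, Set.singleton_union] using h3
  have hy' : Set.range (e ∷ S : Fin (n + 1) → E) = Set.range y := by
    simp only [range_cons_eq_insert, hSr]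
    rw [← Set.singleton_union, ← he, Set.inter_comm, Set.sdiff_union_inter]
  obtain ⟨σ, rfl⟩ := exists_perm_of_range_eq
    (injective_of_ncard_range (by rw [hx', hcx])) hx hx'
  obtain ⟨τ, rfl⟩ := exists_perm_of_range_eq
    (injective_of_ncard_range (by rw [hy', hcy])) hy hy'
  rw [hf.pluckerSum_comp, hf.pluckerSum_cons]
  exact h _ _ _ _ _

end IsAlternating

end Tract

namespace WeakGPFunction

variable {G : Type*} [CommGroup G] {T : Tract G} {E : Type*} {d : ℕ}

theorem isAlternating (φ : WeakGPFunction T E d) : T.IsAlternating φ.toFun where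
  swap := φ.swap
  eq_zero x hx := by
    rw [Function.Injective] at hx
    push Not at hx
    obtain ⟨i, j, hij, hne⟩ := hx
    exact φ.eq_zero x i j hne hij

/-- Removes the disjointness assumptions from (GP3)'. Equal letters give a formal identity; if the
letters differ but `a, b, c, e, S` still has a repetition, it involves `S` and all three products
vanish. -/
theorem threeTerm (φ : WeakGPFunction T E (d + 1)) (S : Fin d → E) (a b c e : E) :
    T.ThreeTerm φ.toFun S a b c e := by
  have hφ := φ.isAlternating
  by_cases heq : a = b ∨ a = c ∨ a = e ∨ b = c ∨ b = e ∨ c = e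
  · exact hφ.threeTerm_of_eq heq
  by_cases hi : (a ∷ b ∷ c ∷ e ∷ S : Fin (d + 4) → E).Injective
  · rw [← hφ.pluckerSum_cons]
    simp only [injective_cons_iff, range_cons_eq_insert, Set.mem_insert_iff, not_or] at hi heq
    obtain ⟨⟨hab, hac, hae, ha⟩, ⟨hbc, hbe, hb⟩, ⟨hce, hc⟩, he, hS⟩ := hi
    refine φ.three_term _ _ ?_ ?_ ?_
    · simp only [injective_cons_iff, range_cons_eq_insert, Set.mem_insert_iff, not_or]
      exact ⟨⟨hab, hac, ha⟩, ⟨hbc, hb⟩, hc, hS⟩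
    · exact injective_cons_iff.2 ⟨he, hS⟩
    · refine Set.ncard_eq_three.2 ⟨a, b, c, hab, hac, hbc, ?_⟩
      simp only [range_cons_eq_insert]
      ext g
      simp only [Set.mem_sdiff, Set.mem_insert_iff, Set.mem_singleton_iff]
      constructor
      · tauto
      · rintro (rfl | rfl | rfl) <;> tauto
  · have key : ∀ p q r s : E, ({p, q, r, s} : Set E) = {a, b, c, e} →
        φ.toFun (p ∷ q ∷ S) * φ.toFun (r ∷ s ∷ S) = 0 := by
      intro p q r s hp
      by_contra hne
      have h1 : (p ∷ q ∷ S : Fin (d + 2) → E).Injective := by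
        by_contra h
        exact hne (by rw [hφ.eq_zero _ h, zero_mul])
      have h2 : (r ∷ s ∷ S : Fin (d + 2) → E).Injective := by
        by_contra h
        exact hne (by rw [hφ.eq_zero _ h, mul_zero])
      simp only [injective_cons_iff, range_cons_eq_insert, Set.mem_insert_iff, not_or] at h1 h2 heq
      have hS : ∀ g ∈ ({p, q, r, s} : Set E), g ∉ Set.range S := by
        simp only [Set.mem_insert_iff, Set.mem_singleton_iff]
        rintro g (rfl | rfl | rfl | rfl) <;> tauto
      rw [hp] at hS
      apply hi
      simp only [injective_cons_iff, range_cons_eq_insert, Set.mem_insert_iff, not_or]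
      have ha := hS a (by simp)
      have hb := hS b (by simp)
      have hc := hS c (by simp)
      have he := hS e (by simp)
      tauto
    rw [Tract.ThreeTerm, key a b c e rfl, key a c b e, key b c a e]
    · simpa using T.zero_mem
    all_goals
      ext g
      simp only [Set.mem_insert_iff, Set.mem_singleton_iff]
      tauto

theorem range_of_ne_zero (φ : WeakGPFunction T E d) (x : Fin (d + 1) → E) :
    φ.toFun x ≠ 0 ↔ x.Injective ∧ φ.underlying.IsBase (Set.range x) := by
  have hφ := φ.isAlternating
  have inj : ∀ x, φ.toFun x ≠ 0 → x.Injective := fun x hx => by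
    by_contra h
    exact hx (hφ.eq_zero x h)
  constructor
  · intro h
    exact ⟨inj x h, (φ.underlying_isBase _).2 ⟨x, h, rfl⟩⟩
  · rintro ⟨hx, hB⟩
    obtain ⟨y, hy, hyx⟩ := (φ.underlying_isBase _).1 hB
    obtain ⟨σ, rfl⟩ := exists_perm_of_range_eq (inj y hy) hx hyx
    rw [hφ.comp_perm]
    exact mul_ne_zero (T.signHom_ne_zero _) hy

end WeakGPFunction

/-! ### The basis graph: exchange paths and integration of local potentials. -/

namespace Matroid

variable {E : Type*} {M : Matroid E}

/-- The bases that contain `I` and avoid `J` are connected by exchanges of single elements. -/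
theorem isBase_induction [Finite E] {I J : Set E} {P : Set E → Prop} {B₁ B₂ : Set E}
    (h₁ : M.IsBase B₁) (h₂ : M.IsBase B₂) (hI₁ : I ⊆ B₁) (hI₂ : I ⊆ B₂)
    (hJ₁ : Disjoint B₁ J) (hJ₂ : Disjoint B₂ J)
    (hstep : ∀ (S : Set E) (u v : E), u ∉ S → v ∉ S → u ≠ v → M.IsBase (insert u S) →
      M.IsBase (insert v S) → I ⊆ S → Disjoint (insert u S) J → Disjoint (insert v S) J →
      P (insert u S) → P (insert v S))
    (hP : P B₁) : P B₂ := by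
  -- Each exchange towards `B₂` keeps the common part of both bases and adds only elements of `B₂`,
  -- so `I` and `J` stay respected.
  induction hn : (B₁ \ B₂).ncard using Nat.strong_induction_on generalizing B₁ with
  | _ n ih =>
    by_cases hsub : B₁ ⊆ B₂
    · rwa [← h₁.eq_of_subset_isBase h₂ hsub]
    · obtain ⟨u, hu₁, hu₂⟩ := Set.not_subset.1 hsub
      obtain ⟨v, ⟨hv₂, hv₁⟩, hB⟩ := h₁.exchange h₂ ⟨hu₁, hu₂⟩
      have huB : insert u (B₁ \ {u}) = B₁ := by simp [hu₁]
      have hIS : I ⊆ B₁ \ {u} := fun g hg => ⟨hI₁ hg, fun h => hu₂ (h ▸ hI₂ hg)⟩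
      have hJv : Disjoint (insert v (B₁ \ {u})) J := by
        rw [Set.disjoint_insert_left]
        exact ⟨Set.disjoint_left.1 hJ₂ hv₂, hJ₁.mono_left Set.sdiff_subset⟩
      refine ih _ ?_ hB (hIS.trans (Set.subset_insert _ _)) hJv ?_ rfl
      · rw [← hn]
        apply Set.ncard_lt_ncard _ (Set.toFinite _)
        refine ⟨fun g hg => ?_, fun h => ?_⟩
        · obtain ⟨rfl | hg1, hg2⟩ := hg
          · exact absurd hv₂ hg2
          · exact ⟨hg1.1, hg2⟩
        · obtain ⟨rfl | hg1, -⟩ := h ⟨hu₁, hu₂⟩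
          · exact hv₁ hu₁
          · exact hg1.2 rfl
      · exact hstep _ u v (by simp) (fun h => hv₁ h.1) (by rintro rfl; exact hv₁ hu₁)
          (huB.symm ▸ h₁) hB hIS (huB.symm ▸ hJ₁) hJv (huB.symm ▸ hP)

/-- Multiplicative data on pairs of adjacent bases `insert e S`, `insert f S` that satisfy the
local conditions for being of the form `ψ (insert e S) / ψ (insert f S)`. -/
structure LocalPotential (M : Matroid E) {A : Type*} [CommGroup A] (w : Set E → E → E → A) :
    Prop where
  cocycle : ∀ (S : Set E) (e f g : E), e ∉ S → f ∉ S → g ∉ S → M.IsBase (insert e S) →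
    M.IsBase (insert f S) → M.IsBase (insert g S) → w S e f * w S f g = w S e g
  triangle : ∀ (S : Set E) (a b c : E), a ∉ S → b ∉ S → c ∉ S → a ≠ b → a ≠ c → b ≠ c →
    M.IsBase (insert a (insert b S)) → M.IsBase (insert a (insert c S)) →
    M.IsBase (insert b (insert c S)) →
    w (insert a S) b c * w (insert b S) c a * w (insert c S) a b = 1
  square : ∀ (S : Set E) (a b c f : E), a ∉ S → b ∉ S → c ∉ S → f ∉ S → a ≠ b → a ≠ c →
    b ≠ c → a ≠ f → b ≠ f → c ≠ f → M.IsBase (insert a (insert b S)) →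
    M.IsBase (insert a (insert c S)) → M.IsBase (insert f (insert b S)) →
    M.IsBase (insert f (insert c S)) → ¬ M.IsBase (insert b (insert c S)) →
    ¬ M.IsBase (insert a (insert f S)) →
    w (insert b S) a f * w (insert f S) b c = w (insert a S) b c * w (insert c S) a f

namespace LocalPotential

variable {A : Type*} [CommGroup A] {w : Set E → E → E → A}

theorem self (hw : M.LocalPotential w) {S : Set E} {e : E} (he : e ∉ S)
    (h : M.IsBase (insert e S)) : w S e e = 1 :=
  mul_eq_left.1 (hw.cocycle S e e e he he he h h h)

theorem symm (hw : M.LocalPotential w) {S : Set E} {e f : E} (he : e ∉ S) (hf : f ∉ S)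
    (h : M.IsBase (insert e S)) (h' : M.IsBase (insert f S)) : w S f e = (w S e f)⁻¹ :=
  eq_inv_of_mul_eq_one_left ((hw.cocycle S f e f hf he hf h' h h').trans (hw.self hf h'))

/-- The square relation, when one of the diagonals is not a base. -/
theorem square' (hw : M.LocalPotential w) {S : Set E} {a b c f : E} (ha : a ∉ S) (hb : b ∉ S)
    (hc : c ∉ S) (hf : f ∉ S) (hab : a ≠ b) (hac : a ≠ c) (hbc : b ≠ c) (haf : a ≠ f)
    (hbf : b ≠ f) (hcf : c ≠ f) (h1 : M.IsBase (insert a (insert b S)))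
    (h2 : M.IsBase (insert a (insert c S))) (h3 : M.IsBase (insert f (insert b S)))
    (h4 : M.IsBase (insert f (insert c S))) (h5 : ¬ M.IsBase (insert b (insert c S))) :
    w (insert b S) a f * w (insert f S) b c = w (insert a S) b c * w (insert c S) a f := by
  by_cases h6 : M.IsBase (insert a (insert f S))
  -- The diagonal base `insert a (insert f S)` cuts the square into two triangles, which are glued
  -- by the cocycle rule.
  · have t1 := hw.triangle S a b f ha hb hf hab haf hbf h1 h6 (Set.insert_comm b f S ▸ h3)
    have t2 := hw.triangle S a c f ha hc hf hac haf hcf h2 h6 (Set.insert_comm c f S ▸ h4)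
    have h1' := Set.insert_comm b a S ▸ h1
    have h2' := Set.insert_comm c a S ▸ h2
    have h3' := Set.insert_comm b f S ▸ h3
    have h4' := Set.insert_comm c f S ▸ h4
    have h6' := Set.insert_comm f a S ▸ h6
    have e1 := hw.symm (S := insert b S) (e := a) (f := f) (by simp [*]) (by simp [hbf.symm, *]) h1 h3
    have e2 := hw.symm (S := insert c S) (e := a) (f := f) (by simp [*]) (by simp [hcf.symm, *]) h2 h4
    have c1 := hw.cocycle (insert a S) b c f (by simp [hab.symm, *]) (by simp [hac.symm, *])
      (by simp [haf.symm, *]) h1' h2' h6'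
    have c2 := hw.cocycle (insert f S) a b c (by simp [*]) (by simp [*]) (by simp [*]) h6 h3' h4'
    rw [e1, mul_right_comm, mul_inv_eq_one] at t1
    rw [e2, mul_right_comm, mul_inv_eq_one] at t2
    rw [← t1, ← t2, ← c1, ← c2]
    simp only [mul_assoc]
  · exact hw.square S a b c f ha hb hc hf hab hac hbc haf hbf hcf h1 h2 h3 h4 h5 h6

/-- The bases considered contain `I` and avoid `J`, so `I` is contracted and `J` deleted. An
undecided element `a` splits them into those through `a`, with potential `ψ₁`, and those avoiding
it, with potential `ψ₀`. One constant `l` must reconcile the two along all exchanges between these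
classes. -/
theorem exists_potential_aux [Finite E] (hw : M.LocalPotential w) (n : ℕ) :
    ∀ I J : Set E, Disjoint I J → (I ∪ J)ᶜ.ncard = n → ∃ ψ : Set E → A, ∀ (S : Set E) (e f : E),
      e ∉ S → f ∉ S → M.IsBase (insert e S) → M.IsBase (insert f S) →
      I ⊆ insert e S → I ⊆ insert f S → Disjoint (insert e S) J → Disjoint (insert f S) J →
      ψ (insert e S) = w S e f * ψ (insert f S) := by
  induction n with
  | zero =>
    intro I J hIJ hn
    refine ⟨1, fun S e f he hf h1 h2 hI1 hI2 hJ1 hJ2 => ?_⟩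
    -- Every element is already decided, so at most one base is admissible and `e = f`.
    have hU : ∀ g, g ∈ I ∨ g ∈ J := by
      rw [Set.ncard_eq_zero, Set.compl_empty_iff] at hn
      exact fun g => hn.symm.subset (Set.mem_univ g)
    have : e ∈ I := (hU e).resolve_right (Set.disjoint_left.1 hJ1 (Set.mem_insert e S))
    obtain rfl : e = f := (hI2 this).resolve_right he
    rw [hw.self he h1, one_mul]
  | succ n ih =>
    intro I J hIJ hn
    obtain ⟨a, ha⟩ : (I ∪ J)ᶜ.Nonempty := by
      rw [← Set.ncard_pos]; omega
    have ha' := ha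
    rw [Set.mem_compl_iff, Set.mem_union, not_or] at ha'
    obtain ⟨haI, haJ⟩ := ha'
    have hn' : (insert a (I ∪ J))ᶜ.ncard = n := by
      have : (insert a (I ∪ J))ᶜ = (I ∪ J)ᶜ \ {a} := by
        ext g; simp only [Set.mem_compl_iff, Set.mem_insert_iff, Set.mem_sdiff,
          Set.mem_singleton_iff]; tauto
      rw [this, Set.ncard_sdiff_singleton_of_mem ha]; omega
    obtain ⟨ψ₁, h₁⟩ := ih (insert a I) J (Set.disjoint_insert_left.2 ⟨haJ, hIJ⟩)
      (by rw [Set.insert_union]; exact hn')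
    obtain ⟨ψ₀, h₀⟩ := ih I (insert a J) (Set.disjoint_insert_right.2 ⟨haI, hIJ⟩)
      (by rw [Set.union_insert]; exact hn')
    -- A link is an exchange of `a` for `f` between the two classes of bases; `L S f` is the
    -- constant by which it forces `ψ₁` to be rescaled.
    let Link : Set E → E → Prop := fun S f => a ∉ S ∧ f ∉ S ∧ f ≠ a ∧ M.IsBase (insert a S) ∧
      M.IsBase (insert f S) ∧ I ⊆ S ∧ Disjoint S J ∧ f ∉ J
    let L : Set E → E → A := fun S f => w S a f * ψ₀ (insert f S) / ψ₁ (insert a S)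
    have same : ∀ S f g, Link S f → Link S g → L S f = L S g := by
      rintro S f g ⟨haS, hfS, hfa, hBa, hBf, hIS, hJS, hfJ⟩ ⟨-, hgS, hga, -, hBg, -, -, hgJ⟩
      have hd : ∀ g, g ≠ a → g ∉ J → Disjoint (insert g S) (insert a J) := fun g hg hgJ => by
        rw [Set.disjoint_insert_left, Set.disjoint_insert_right]
        exact ⟨by simp [hg, hgJ], haS, hJS⟩
      simp only [L]
      rw [h₀ S f g hfS hgS hBf hBg (hIS.trans (Set.subset_insert _ _))
        (hIS.trans (Set.subset_insert _ _)) (hd f hfa hfJ) (hd g hga hgJ), ← mul_assoc,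
        hw.cocycle S a f g haS hfS hgS hBa hBf hBg]
    -- A link at one base through `a` yields a link with the same constant at any adjacent base
    -- through `a`.
    have step : ∀ S b c f, b ∉ S → c ∉ S → b ≠ c → M.IsBase (insert a (insert c S)) →
        I ⊆ S → c ∉ J → c ≠ a → Link (insert b S) f →
        ∃ f', Link (insert c S) f' ∧ L (insert b S) f = L (insert c S) f' := by
      intro S b c f hbS hcS hbc hBac hIS hcJ hca hL
      have hL' := hL
      obtain ⟨haS, hfS, hfa, hBab, hBfb, -, hJS, hfJ⟩ := hL'
      rw [Set.mem_insert_iff, not_or] at haS hfS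
      rw [Set.disjoint_insert_left] at hJS
      have hψ₁ : ψ₁ (insert a (insert b S)) = w (insert a S) b c * ψ₁ (insert a (insert c S)) := by
        rw [Set.insert_comm a b, Set.insert_comm a c]
        apply h₁ (insert a S) b c
        · simp [(Ne.symm haS.1), hbS]
        · simp [hca, hcS]
        · rwa [Set.insert_comm]
        · rwa [Set.insert_comm]
        · exact (Set.insert_subset_insert hIS).trans (Set.subset_insert _ _)
        · exact (Set.insert_subset_insert hIS).trans (Set.subset_insert _ _)
        · simp only [Set.disjoint_insert_left]; exact ⟨hJS.1, haJ, hJS.2⟩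
        · simp only [Set.disjoint_insert_left]; exact ⟨hcJ, haJ, hJS.2⟩
      -- If this is a base, then `c` and `b` serve as links at the two ends and a triangle compares
      -- them. Otherwise exchange makes `f` itself a link at both ends, and the square relation
      -- applies.
      by_cases hBbc : M.IsBase (insert b (insert c S))
      · have hBcb : M.IsBase (insert c (insert b S)) := Set.insert_comm b c S ▸ hBbc
        have hLc : Link (insert b S) c := ⟨by simp [haS], by simp [hbc.symm, hcS], hca, hBab,
          hBcb, hIS.trans (Set.subset_insert _ _), Set.disjoint_insert_left.2 hJS, hcJ⟩
        have hLb : Link (insert c S) b := ⟨by simp [haS.2, hca.symm], by simp [hbc, hbS],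
          (Ne.symm haS.1), hBac, hBbc, hIS.trans (Set.subset_insert _ _),
          Set.disjoint_insert_left.2 ⟨hcJ, hJS.2⟩, hJS.1⟩
        refine ⟨b, hLb, (same _ _ _ hL hLc).trans ?_⟩
        have t := hw.triangle S a b c haS.2 hbS hcS haS.1 hca.symm hbc hBab hBac hBbc
        rw [hw.symm hLc.1 hLc.2.1 hBab hBcb, mul_right_comm, mul_inv_eq_one] at t
        simp only [L]
        rw [hψ₁, ← t, Set.insert_comm b c, mul_assoc, mul_div_mul_left_eq_div]
      · have hfc : f ≠ c := by
          rintro rfl; exact hBbc (Set.insert_comm f b S ▸ hBfb)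
        have hBfc : M.IsBase (insert f (insert c S)) := by
          obtain ⟨y, hy, hyB⟩ := hBac.exchange hBfb (e := a)
            ⟨Set.mem_insert _ _, by simp [haS, hfa.symm]⟩
          rw [Set.insert_sdiff_self_of_notMem (by simp [haS.2, hca.symm])] at hyB
          simp only [Set.mem_sdiff, Set.mem_insert_iff, not_or] at hy
          obtain ⟨rfl | rfl | hy1, hy2⟩ := hy
          · exact hyB
          · exact absurd hyB hBbc
          · exact absurd hy1 hy2.2.2
        have hLf : Link (insert c S) f := ⟨by simp [haS.2, hca.symm], by simp [hfc, hfS.2], hfa,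
          hBac, hBfc, hIS.trans (Set.subset_insert _ _),
          Set.disjoint_insert_left.2 ⟨hcJ, hJS.2⟩, hfJ⟩
        refine ⟨f, hLf, ?_⟩
        have hψ₀ : ψ₀ (insert f (insert b S)) =
            w (insert f S) b c * ψ₀ (insert f (insert c S)) := by
          rw [Set.insert_comm f b, Set.insert_comm f c]
          apply h₀ (insert f S) b c
          · simp [Ne.symm hfS.1, hbS]
          · simp [hfc.symm, hcS]
          · rwa [Set.insert_comm]
          · rwa [Set.insert_comm]
          · exact (hIS.trans (Set.subset_insert _ _)).trans (Set.subset_insert _ _)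
          · exact (hIS.trans (Set.subset_insert _ _)).trans (Set.subset_insert _ _)
          · simp only [Set.disjoint_insert_left, Set.disjoint_insert_right, Set.mem_insert_iff,
              not_or]
            have := hJS.1; have := hJS.2; have := Ne.symm hfa; tauto
          · simp only [Set.disjoint_insert_left, Set.disjoint_insert_right, Set.mem_insert_iff,
              not_or]
            have := hJS.2; have := hca.symm; have := Ne.symm hfa; tauto
        have sq := hw.square' haS.2 hbS hcS hfS.2 haS.1 hca.symm hbc hfa.symm (Ne.symm hfS.1)
          hfc.symm hBab hBac hBfb hBfc hBbc
        simp only [L]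
        rw [hψ₀, hψ₁, ← mul_assoc, sq, mul_assoc, mul_div_mul_left_eq_div]
    -- Bases through `a` are connected by exchanges, and `step` carries links along such a path.
    have const : ∀ S₁ f₁ S₂ f₂, Link S₁ f₁ → Link S₂ f₂ → L S₂ f₂ = L S₁ f₁ := by
      intro S₁ f₁ S₂ f₂ hL₁ hL₂
      have inj : ∀ S S' : Set E, a ∉ S → a ∉ S' → insert a S = insert a S' → S = S' := by
        intro S S' h h' heq
        rw [← Set.insert_sdiff_self_of_notMem h, heq, Set.insert_sdiff_self_of_notMem h']
      have dis : ∀ S f, Link S f → Disjoint (insert a S) J := fun S f h =>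
        Set.disjoint_insert_left.2 ⟨haJ, h.2.2.2.2.2.2.1⟩
      have hind := isBase_induction (I := insert a I) (J := J)
        (P := fun B => ∀ S f, insert a S = B → Link S f → L S f = L S₁ f₁)
        hL₁.2.2.2.1 hL₂.2.2.2.1 (Set.insert_subset_insert hL₁.2.2.2.2.2.1)
        (Set.insert_subset_insert hL₂.2.2.2.2.2.1) (dis _ _ hL₁) (dis _ _ hL₂)
      refine hind ?_ ?_ S₂ f₂ rfl hL₂
      · intro S u v hu hv huv hBu hBv hIS hJu hJv hP S' f hS' hL
        have haS : a ∈ S := hIS (Set.mem_insert _ _)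
        have hins : insert a (S \ {a}) = S := by simp [haS]
        have hua : u ≠ a := by rintro rfl; exact hu haS
        have hva : v ≠ a := by rintro rfl; exact hv haS
        obtain rfl : S' = insert v (S \ {a}) := by
          apply inj _ _ hL.1 (by simp [hva.symm])
          rw [hS', Set.insert_comm, hins]
        obtain ⟨f', hf', heq⟩ := step (S \ {a}) v u f (fun h => hv h.1) (fun h => hu h.1)
          huv.symm (by rwa [Set.insert_comm, hins])
          (fun g hg => ⟨hIS (Set.mem_insert_of_mem _ hg), fun h => haI (h ▸ hg)⟩)
          (Set.disjoint_left.1 hJu (Set.mem_insert _ _)) hua hL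
        rw [heq]
        exact hP _ _ (by rw [Set.insert_comm, hins]) hf'
      · intro S f hS hL
        obtain rfl := inj _ _ hL.1 hL₁.1 hS
        exact same _ _ _ hL hL₁
    -- Without any link the two classes never interact and the constant is arbitrary.
    obtain ⟨l, hl⟩ : ∃ l, ∀ S f, Link S f → L S f = l := by
      by_cases h : ∃ S f, Link S f
      · obtain ⟨S, f, h⟩ := h
        exact ⟨_, fun S' f' h' => const _ _ _ _ h h'⟩
      · push Not at h
        exact ⟨1, fun S f hL => absurd hL (h S f)⟩
    have cross : ∀ S f, Link S f → l * ψ₁ (insert a S) = w S a f * ψ₀ (insert f S) := by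
      intro S f hL
      rw [← hl S f hL, div_mul_cancel]
    classical
    refine ⟨fun B => if a ∈ B then l * ψ₁ B else ψ₀ B, fun S e f he hf h1 h2 hI1 hI2 hJ1 hJ2 => ?_⟩
    by_cases haS : a ∈ S
    · simp only [Set.mem_insert_iff, haS, or_true, if_true]
      rw [h₁ S e f he hf h1 h2 (Set.insert_subset (Or.inr haS) hI1)
        (Set.insert_subset (Or.inr haS) hI2) hJ1 hJ2, mul_left_comm]
    · have link : ∀ f, f ∉ S → f ≠ a → M.IsBase (insert a S) → M.IsBase (insert f S) →
          I ⊆ insert a S → Disjoint (insert f S) J → Link S f := by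
        intro f hf hfa h h' hI hJ
        rw [Set.disjoint_insert_left] at hJ
        exact ⟨haS, hf, hfa, h, h', fun g hg => (hI hg).resolve_left (fun h => haI (h ▸ hg)),
          hJ.2, hJ.1⟩
      have hmem : ∀ g, a ∈ insert g S ↔ a = g := fun g => by simp [haS]
      simp only [hmem]
      by_cases hea : a = e <;> by_cases hfa : a = f
      · subst hea; subst hfa
        rw [hw.self he h1, one_mul]
      · subst hea
        rw [if_pos rfl, if_neg hfa]
        exact cross S f (link f hf (Ne.symm hfa) h1 h2 hI1 hJ2)
      · subst hfa
        rw [if_pos rfl, if_neg hea, cross S e (link e he (Ne.symm hea) h2 h1 hI2 hJ1),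
          hw.symm hf he h2 h1, inv_mul_cancel_left]
      · rw [if_neg hea, if_neg hfa]
        apply h₀ S e f he hf h1 h2 hI1 hI2 <;> rw [Set.disjoint_insert_right]
        · exact ⟨by simp [hea, haS], hJ1⟩
        · exact ⟨by simp [hfa, haS], hJ2⟩

/-- Local potentials are globally integrable. -/
theorem exists_potential [Finite E] (hw : M.LocalPotential w) : ∃ ψ : Set E → A,
    ∀ (S : Set E) (e f : E), e ∉ S → f ∉ S → M.IsBase (insert e S) → M.IsBase (insert f S) →
      ψ (insert e S) = w S e f * ψ (insert f S) := by
  obtain ⟨ψ, h⟩ := hw.exists_potential_aux _ ∅ ∅ (Set.disjoint_empty _) rfl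
  exact ⟨ψ, fun S e f he hf h1 h2 => h S e f he hf h1 h2 (Set.empty_subset _)
    (Set.empty_subset _) (Set.disjoint_empty _) (Set.disjoint_empty _)⟩


end LocalPotential

end Matroid

/-! ### Circuits over a base and modular pairs. -/

namespace Matroid

variable {E : Type*} {M : Matroid E}

theorem IsBase.eq_of_isCircuit_subset_insert {B C C' : Set E} {e : E} (hB : M.IsBase B)
    (hC : M.IsCircuit C) (hC' : M.IsCircuit C') (h : C ⊆ insert e B) (h' : C' ⊆ insert e B) :
    C = C' :=
  (hC.eq_fundCircuit_of_subset hB.indep h).trans (hC'.eq_fundCircuit_of_subset hB.indep h').symm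

theorem IsBase.mem_of_isCircuit_subset_insert {B C : Set E} {e : E} (hB : M.IsBase B)
    (hC : M.IsCircuit C) (h : C ⊆ insert e B) : e ∈ C ∧ e ∉ B := by
  have h1 : e ∉ B := fun he => hC.not_indep
    (hB.indep.subset (by rwa [Set.insert_eq_of_mem he] at h))
  refine ⟨?_, h1⟩
  by_contra he
  exact hC.not_indep (hB.indep.subset ((Set.subset_insert_iff_of_notMem he).1 h))

theorem IsBase.isBase_insert_sdiff_iff {B C : Set E} {e g : E} (hB : M.IsBase B)
    (hC : M.IsCircuit C) (h : C ⊆ insert e B) (hg : g ∈ insert e B) :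
    M.IsBase (insert e B \ {g}) ↔ g ∈ C := by
  obtain ⟨heC, heB⟩ := hB.mem_of_isCircuit_subset_insert hC h
  have hecl : e ∈ M.closure B := by
    rw [hB.closure_eq]; exact hC.subset_ground heC
  constructor
  · intro hb
    by_contra hgC
    exact hC.not_indep (hb.indep.subset (Set.subset_sdiff_singleton h hgC))
  · intro hgC
    rcases eq_or_ne g e with rfl | hne
    · rwa [Set.insert_sdiff_self_of_notMem heB]
    · have hgB : g ∈ B := hg.resolve_left hne
      rw [hC.eq_fundCircuit_of_subset hB.indep h, hB.indep.mem_fundCircuit_iff hecl heB] at hgC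
      exact hB.exchange_isBase_of_indep' hgB heB hgC

/-- The fundamental circuits of two elements over a base form a modular pair. -/
theorem IsBase.isModularPair {B C D : Set E} {a b : E} (hB : M.IsBase B) (hab : a ≠ b)
    (hC : M.IsCircuit C) (hD : M.IsCircuit D) (hCs : C ⊆ insert a B) (hDs : D ⊆ insert b B) :
    IsModularPair {C | M.IsCircuit C} C D := by
  have ha := hB.mem_of_isCircuit_subset_insert hC hCs
  have hb := hB.mem_of_isCircuit_subset_insert hD hDs
  -- Once some `x ∈ C` is omitted, the rest of `C ∪ D` lies in the base `insert a B \ {x}` together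
  -- with `b`, which contains at most one circuit.
  have main : ∀ {C D : Set E} {a b : E}, M.IsCircuit C → C ⊆ insert a B → D ⊆ insert b B →
      ∀ {A' B' : Set E}, M.IsCircuit A' → M.IsCircuit B' → A' ∪ B' ⊆ C ∪ D →
      ∀ x ∈ C, x ∉ A' ∪ B' → A' = B' := by
    intro C D a b hC hCs hDs A' B' hA' hB' hs x hxC hx
    have hbase : M.IsBase (insert a B \ {x}) :=
      (hB.isBase_insert_sdiff_iff hC hCs (hCs hxC)).2 hxC
    have hsub : A' ∪ B' ⊆ insert b (insert a B \ {x}) := by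
      intro g hg
      have hgx : g ≠ x := by rintro rfl; exact hx hg
      rcases hs hg with h | h
      · exact Or.inr ⟨hCs h, hgx⟩
      · rcases hDs h with h | h
        · exact Or.inl h
        · exact Or.inr ⟨Or.inr h, hgx⟩
    exact hbase.eq_of_isCircuit_subset_insert hA' hB' (Set.subset_union_left.trans hsub)
      (Set.subset_union_right.trans hsub)
  refine ⟨hC, hD, ?_, ?_⟩
  · rintro rfl
    rcases hDs ha.1 with h | h
    · exact hab h
    · exact ha.2 h
  · rintro ⟨A', hA', B', hB', hne, hss⟩
    obtain ⟨x, hx, hx'⟩ := Set.exists_of_ssubset hss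
    rcases hx with hxC | hxD
    · exact hne (main hC hCs hDs hA' hB' hss.subset x hxC hx')
    · exact hne (main hD hDs hCs hA' hB' (Set.union_comm C D ▸ hss.subset) x hxD hx')

/-- A circuit `D` avoiding `a` and `b` would differ from `B`, and `D ∪ B` would miss `a`, against
modularity. Extending this set to a base makes `A` and `B` fundamental circuits over one base. -/
theorem indep_of_isModularPair (hE : M.E = Set.univ) {A B : Set E} {a b : E}
    (h : IsModularPair {C | M.IsCircuit C} A B) (ha : a ∈ A) (haB : a ∉ B) (hb : b ∈ B) :
    M.Indep ((A ∪ B) \ {a, b}) := by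
  rw [indep_iff_forall_subset_not_isCircuit (by rw [hE]; exact Set.subset_univ _)]
  intro D hDs hD
  have hDb : D ≠ B := by
    rintro rfl
    exact (hDs hb).2 (by simp)
  refine h.2.2.2 ⟨D, hD, B, h.2.1, hDb, ?_, ?_⟩
  · exact Set.union_subset (hDs.trans Set.sdiff_subset) Set.subset_union_right
  · intro hs
    rcases hs (Or.inl ha) with h1 | h1
    · exact (hDs h1).2 (by simp)
    · exact haB h1

end Matroid

/-! ### The division-free relation between circuit vectors and basis values. -/

namespace Tract

variable {G : Type*} [CommGroup G] {E : Type*} {n : ℕ} (T : Tract G)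

/-- The relations between the values of a Grassmann–Plücker function `f` and a vector `X` that
express that `X` is an `F`-circuit of `f`, in division-free form. -/
def CircuitRelation (f : (Fin (n + 1) → E) → WithZero G) (X : E → WithZero G) : Prop :=
  ∀ (e e' : E) (S : Fin n → E), supp X ⊆ insert e (insert e' (Set.range S)) →
    X e * f (e ∷ S) = T.negOne * (X e' * f (e' ∷ S))

/-- The function `f` is alternating, and its support consists of the bases of `M`. -/
structure IsSupportedOn (f : (Fin (n + 1) → E) → WithZero G) (M : Matroid E) : Prop
    extends T.IsAlternating f where
  ne_zero_iff : ∀ x, f x ≠ 0 ↔ x.Injective ∧ M.IsBase (Set.range x)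

variable {T} {f : (Fin (n + 1) → E) → WithZero G} {M : Matroid E} {X : E → WithZero G}

theorem CircuitRelation.mul_left (h : T.CircuitRelation f X) (α : WithZero G) (hα : α ≠ 0) :
    T.CircuitRelation f (fun e => α * X e) := by
  intro e e' S hS
  have hs : supp (fun e => α * X e) = supp X := by
    ext g; simp [supp, hα]
  rw [mul_assoc, h e e' S (hs ▸ hS), mul_assoc, mul_left_comm]

theorem supp_mul_left (α : G) (X : E → WithZero G) :
    supp (fun e => (α : WithZero G) * X e) = supp X := by
  ext g; simp [supp]

namespace IsSupportedOn

theorem isBase (hf : T.IsSupportedOn f M) {x : Fin (n + 1) → E} (hx : f x ≠ 0) :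
    M.IsBase (Set.range x) := ((hf.ne_zero_iff x).1 hx).2

theorem ncard_of_isBase [Finite E] (hf : T.IsSupportedOn f M) (h : ∃ x, f x ≠ 0) {B : Set E}
    (hB : M.IsBase B) : B.ncard = n + 1 := by
  obtain ⟨x, hx⟩ := h
  rw [hB.ncard_eq_ncard_of_isBase (hf.isBase hx),
    ncard_range_of_injective ((hf.ne_zero_iff x).1 hx).1]

theorem eq_zero_of_subset (hf : T.IsSupportedOn f M) {C : Set E} (hC : M.IsCircuit C)
    {x : Fin (n + 1) → E} (h : C ⊆ Set.range x) : f x = 0 := by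
  by_contra hx
  exact hC.not_indep ((hf.isBase hx).indep.subset h)

theorem apply_ne_zero (hf : T.IsSupportedOn f M) (hX : M.IsCircuit (supp X)) {e e' : E}
    {S : Fin n → E} (hS : supp X ⊆ insert e (insert e' (Set.range S))) (h : f (e' ∷ S) ≠ 0) :
    X e ≠ 0 := by
  have hB := hf.isBase h
  rw [range_cons_eq_insert] at hB
  exact (hB.mem_of_isCircuit_subset_insert hX hS).1

theorem apply_right_ne_zero (hf : T.IsSupportedOn f M) (hX : M.IsCircuit (supp X)) {e e' : E}
    {S : Fin n → E} (hS : supp X ⊆ insert e (insert e' (Set.range S))) (h : f (e ∷ S) ≠ 0) :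
    X e' ≠ 0 :=
  hf.apply_ne_zero hX (Set.insert_comm e e' _ ▸ hS) h

/-- Two circuit vectors with the same support that satisfy the circuit relations are
proportional. -/
theorem exists_eq_mul [Finite E] (hf : T.IsSupportedOn f M) (hne : ∃ x, f x ≠ 0)
    {X Y : E → WithZero G} (hX : M.IsCircuit (supp X)) (hXY : supp X = supp Y)
    (hXr : T.CircuitRelation f X) (hYr : T.CircuitRelation f Y) :
    ∃ α : G, X = fun e => (α : WithZero G) * Y e := by
  obtain ⟨e, he⟩ := hX.nonempty
  have heY : Y e ≠ 0 := by rw [hXY] at he; exact he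
  obtain ⟨α, hα⟩ := WithZero.ne_zero_iff_exists.1 (div_ne_zero (show X e ≠ 0 from he) heY)
  refine ⟨α, funext fun g => ?_⟩
  rw [hα]
  by_cases hge : g = e
  · rw [hge, div_mul_cancel₀ _ heY]
  by_cases hg : g ∈ supp X
  -- A base containing `supp X \ {e}` expresses `X g / X e` and `Y g / Y e` by the same two values
  -- of `f`.
  · obtain ⟨B, hB, hBs⟩ := (hX.sdiff_singleton_indep he).exists_isBase_superset
    have hgB : g ∈ B := hBs ⟨hg, hge⟩
    obtain ⟨S, hS, hSr⟩ := exists_injective_range_eq (n := n) (S := B \ {g}) (by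
      rw [Set.ncard_sdiff_singleton_of_mem hgB, hf.ncard_of_isBase hne hB]; rfl)
    have hBr : Set.range (g ∷ S : Fin (n + 1) → E) = B := by
      rw [range_cons_eq_insert, hSr]; simp [hgB]
    have hfg : f (g ∷ S) ≠ 0 := by
      rw [hf.ne_zero_iff, hBr, injective_cons_iff, hSr]
      exact ⟨⟨by simp, hS⟩, hB⟩
    have hs : supp X ⊆ insert e (insert g (Set.range S)) := by
      rw [← range_cons_eq_insert g, hBr]
      intro a ha
      by_cases hae : a = e
      · exact Or.inl hae
      · exact Or.inr (hBs ⟨ha, hae⟩)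
    have h1 := hXr e g S hs
    have h2 := hYr e g S (hXY ▸ hs)
    rw [div_mul_eq_mul_div, eq_div_iff heY]
    apply mul_right_cancel₀ (mul_ne_zero hfg T.negOne_ne_zero)
    calc X g * Y e * (f (g ∷ S) * T.negOne)
        = Y e * (T.negOne * (X g * f (g ∷ S))) := by
          simp only [mul_comm, mul_left_comm, mul_assoc]
      _ = X e * (Y e * f (e ∷ S)) := by rw [← h1, mul_left_comm]
      _ = _ := by rw [h2]; simp only [mul_comm, mul_left_comm, mul_assoc]
  · have hg' : g ∉ supp Y := hXY ▸ hg
    have h1 : X g = 0 := by simpa [supp] using hg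
    have h2 : Y g = 0 := by simpa [supp] using hg'
    rw [h1, h2, mul_zero]

end IsSupportedOn

end Tract

/-! ### From a Grassmann–Plücker function to vectors on circuits. -/

namespace WeakGPFunction

variable {G : Type*} [CommGroup G] {T : Tract G} {E : Type*} {d : ℕ}

theorem isSupportedOn (φ : WeakGPFunction T E d) : T.IsSupportedOn φ.toFun φ.underlying where
  toIsAlternating := φ.isAlternating
  ne_zero_iff := φ.range_of_ne_zero

/-- The division-free relation is symmetric in `e` and `e'` since `ε² = 1`, and trivial when both
values of `φ` vanish; so one value may be assumed non-zero, where the quotient form makes sense. -/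
theorem mem_circuitSet_iff (φ : WeakGPFunction T E d) (X : E → WithZero G) :
    X ∈ φ.circuitSet ↔
      φ.underlying.IsCircuit (Tract.supp X) ∧ T.CircuitRelation φ.toFun X := by
  have hφ := φ.isSupportedOn
  refine and_congr_right fun hX => ⟨fun h => ?_, fun h => ?_⟩
  · have main : ∀ (e e' : E) (S : Fin d → E),
        Tract.supp X ⊆ insert e (insert e' (Set.range S)) → φ.toFun (e' ∷ S) ≠ 0 →
        X e * φ.toFun (e ∷ S) = T.negOne * (X e' * φ.toFun (e' ∷ S)) := by
      intro e e' S hS hne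
      have hXe := hφ.apply_ne_zero hX hS hne
      have h1 := h e e' S hne (by
        rw [range_cons_eq_insert]
        rintro g ⟨hg, hge⟩
        exact (hS hg).resolve_left hge)
      rw [div_eq_iff hXe, Tract.neg] at h1
      rw [h1, mul_assoc, mul_assoc, Tract.negOne_mul_cancel_left, mul_comm (X e), ← mul_assoc,
        mul_right_comm, div_mul_cancel₀ _ hne]
    intro e e' S hS
    by_cases h1 : φ.toFun (e' ∷ S) = 0
    · by_cases h2 : φ.toFun (e ∷ S) = 0
      · rw [h1, h2]; simp
      · rw [← T.eq_negOne_mul_comm]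
        exact main e' e S (Set.insert_comm e e' _ ▸ hS) h2
    · exact main e e' S hS h1
  · intro e e' S hne hS
    have hs : Tract.supp X ⊆ insert e (insert e' (Set.range S)) := by
      rw [← range_cons_eq_insert e']
      intro g hg
      by_cases hge : g = e
      · exact Or.inl hge
      · exact Or.inr (hS ⟨hg, hge⟩)
    have hXe := hφ.apply_ne_zero hX hs hne
    have h1 := h e e' S hs
    rw [T.eq_negOne_mul_comm] at h1
    rw [div_eq_iff hXe, Tract.neg, mul_div_assoc', div_mul_eq_mul_div, eq_div_iff hne, h1]
    simp only [mul_comm, mul_left_comm]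

theorem mul_mem_circuitSet (φ : WeakGPFunction T E d) {X : E → WithZero G}
    (hX : X ∈ φ.circuitSet) (α : G) : (fun e => (α : WithZero G) * X e) ∈ φ.circuitSet := by
  rw [mem_circuitSet_iff] at hX ⊢
  rw [Tract.supp_mul_left]
  exact ⟨hX.1, hX.2.mul_left α WithZero.coe_ne_zero⟩

theorem circuitSet_eq_of_equiv (φ ψ : WeakGPFunction T E d) (h : φ ≈ ψ) :
    φ.circuitSet = ψ.circuitSet := by
  obtain ⟨g, hg⟩ := h
  have hM : φ.underlying = ψ.underlying := by
    refine Matroid.ext_isBase (by rw [φ.underlying_ground, ψ.underlying_ground]) fun B _ => ?_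
    rw [underlying_isBase, underlying_isBase]
    simp [hg]
  ext X
  rw [mem_circuitSet_iff, mem_circuitSet_iff, hM]
  refine and_congr_right fun _ => ?_
  simp only [Tract.CircuitRelation, hg]
  have hne : (g : WithZero G) ≠ 0 := WithZero.coe_ne_zero
  refine forall₄_congr fun e e' S _ => ?_
  rw [mul_left_comm, mul_left_comm (X e'), mul_left_comm T.negOne, mul_right_inj' hne]

end WeakGPFunction

theorem range_comp_succAbove {E : Type*} {n : ℕ} {x : Fin (n + 1) → E} (hx : x.Injective)
    (k : Fin (n + 1)) : Set.range (x ∘ k.succAbove) = Set.range x \ {x k} := by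
  rw [Set.range_comp, Fin.range_succAbove, Set.image_compl_eq_range_sdiff_image hx,
    Set.image_singleton]

namespace Tract.ThreeTerm

variable {G : Type*} [CommGroup G] {E : Type*} {n : ℕ} {T : Tract G}
  {f : (Fin (n + 2) → E) → WithZero G}

theorem mul_eq_mul (hf : T.IsAlternating f) {S : Fin n → E} {a b c e : E}
    (h : T.ThreeTerm f S a b c e) (hac : f (a ∷ c ∷ S) = 0) :
    f (a ∷ b ∷ S) * f (c ∷ e ∷ S) = f (c ∷ b ∷ S) * f (a ∷ e ∷ S) := by
  rw [ThreeTerm, hac, zero_mul, mul_zero, formal_zero, add_zero, formal_add_mem_null_iff,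
    T.eq_negOne_mul_comm] at h
  rw [hf.cons_swap b c, h, mul_assoc]

end Tract.ThreeTerm

namespace WeakGPFunction

variable {G : Type*} [CommGroup G] {T : Tract G} {E : Type*} {d : ℕ} [Finite E]

/-- Bases containing `C \ {e}` are connected by exchanges that keep `C \ {e}`. Along one exchange a
degenerate three-term relation preserves the ratio of `φ` at `e` and `f`. -/
theorem circuitRelation_transfer (φ : WeakGPFunction T E d) {X : E → WithZero G} {C : Set E}
    (hC : φ.underlying.IsCircuit C) {e f : E} (hf : f ∈ C) (hef : e ≠ f)
    {S₀ S : Fin d → E} (hS₀ : C ⊆ insert e (insert f (Set.range S₀)))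
    (hS : C ⊆ insert e (insert f (Set.range S)))
    (h₀ : φ.toFun (f ∷ S₀) ≠ 0) (h : φ.toFun (f ∷ S) ≠ 0)
    (hrel : X e * φ.toFun (e ∷ S₀) = T.negOne * (X f * φ.toFun (f ∷ S₀))) :
    X e * φ.toFun (e ∷ S) = T.negOne * (X f * φ.toFun (f ∷ S)) := by
  have hφ := φ.isSupportedOn
  have inj : ∀ S S' : Fin d → E, S.Injective → S'.Injective → f ∉ Set.range S →
      f ∉ Set.range S' → Set.range (f ∷ S : Fin (d + 1) → E) = Set.range (f ∷ S' : Fin (d + 1) → E) →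
      ∃ τ : Equiv.Perm (Fin d), S' = S ∘ τ := by
    intro S S' hSi hSi' hfS hfS' heq
    rw [range_cons_eq_insert, range_cons_eq_insert] at heq
    apply exists_perm_of_range_eq hSi hSi'
    rw [← Set.insert_sdiff_self_of_notMem hfS, heq, Set.insert_sdiff_self_of_notMem hfS']
  have perm : ∀ (S : Fin d → E) (τ : Equiv.Perm (Fin d)),
      X e * φ.toFun (e ∷ S) = T.negOne * (X f * φ.toFun (f ∷ S)) →
      X e * φ.toFun (e ∷ (S ∘ τ)) = T.negOne * (X f * φ.toFun (f ∷ (S ∘ τ))) := by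
    intro S τ h
    rw [hφ.cons_comp_perm, hφ.cons_comp_perm, mul_left_comm, h]
    simp only [mul_left_comm]
  have sub : ∀ S : Fin d → E, C ⊆ insert e (insert f (Set.range S)) →
      C \ {e} ⊆ Set.range (f ∷ S : Fin (d + 1) → E) := by
    rintro S hS g ⟨hg, hge⟩
    rw [range_cons_eq_insert]
    exact (hS hg).resolve_left hge
  have hne : ∃ x, φ.toFun x ≠ 0 := ⟨_, h₀⟩
  refine Matroid.isBase_induction (M := φ.underlying) (I := C \ {e}) (J := ∅)
    (P := fun B => ∀ S : Fin d → E, Set.range (f ∷ S : Fin (d + 1) → E) = B →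
      X e * φ.toFun (e ∷ S) = T.negOne * (X f * φ.toFun (f ∷ S)))
    (hφ.isBase h₀) (hφ.isBase h) (sub _ hS₀) (sub _ hS) (Set.disjoint_empty _)
    (Set.disjoint_empty _) ?_ ?_ S rfl
  · intro R u v hu hv huv hBu hBv hR _ _ hP S' hS'
    have hfR : f ∈ R := hR ⟨hf, hef.symm⟩
    have hRc : R.ncard = d := by
      have := hφ.ncard_of_isBase hne hBu
      rw [Set.ncard_insert_of_notMem hu] at this; omega
    have hRf : (R \ {f}).ncard + 1 = d := by
      rw [Set.ncard_sdiff_singleton_add_one hfR, hRc]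
    obtain _ | m := d
    · omega
    obtain ⟨U, hU, hUr⟩ := exists_injective_range_eq (n := m) (S := R \ {f}) (by omega)
    have hRU : insert f (Set.range U) = R := by rw [hUr]; simp [hfR]
    have hr : ∀ g, Set.range (f ∷ g ∷ U : Fin (m + 2) → E) = insert g R := by
      intro g
      rw [range_cons_eq_insert, range_cons_eq_insert, Set.insert_comm, hRU]
    have hz : ∀ g, g ∉ R → φ.underlying.IsBase (insert g R) → φ.toFun (f ∷ g ∷ U) ≠ 0 := by
      intro g hg hb
      rw [hφ.ne_zero_iff]
      refine ⟨injective_of_ncard_range ?_, by rwa [hr]⟩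
      rw [hr, Set.ncard_insert_of_notMem hg, hRc]
    have hfu := hz u hu hBu
    have hfv := hz v hv hBv
    have hS'i : (f ∷ S' : Fin (m + 2) → E).Injective := by
      apply injective_of_ncard_range
      rw [hS', Set.ncard_insert_of_notMem hv, hRc]
    have hvi := ((hφ.ne_zero_iff _).1 hfv).1
    rw [injective_cons_iff] at hS'i hvi
    obtain ⟨τ, rfl⟩ := inj _ _ hvi.2 hS'i.2 hvi.1 hS'i.1 (by rw [hS', hr])
    apply perm
    have h1 := hP (u ∷ U) (hr u)
    -- This tuple covers the circuit `C`, so one product drops out of the three-term relation.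
    have h2 : φ.toFun (e ∷ f ∷ U) = 0 := hφ.eq_zero_of_subset hC (by
      rw [range_cons_eq_insert, range_cons_eq_insert, hRU]
      intro g hg
      by_cases hge : g = e
      · exact Or.inl hge
      · exact Or.inr (hR ⟨hg, hge⟩))
    have h3 := (φ.threeTerm U e v f u).mul_eq_mul hφ.toIsAlternating h2
    apply mul_right_cancel₀ hfu
    rw [mul_assoc, h3, mul_left_comm, h1]
    simp only [mul_comm, mul_left_comm, mul_assoc]
  · intro S' hS'
    have hi₀ := ((hφ.ne_zero_iff _).1 h₀).1
    have hS'i : (f ∷ S' : Fin (d + 1) → E).Injective := by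
      apply injective_of_ncard_range
      rw [hS', ncard_range_of_injective hi₀]
    rw [injective_cons_iff] at hS'i hi₀
    obtain ⟨τ, rfl⟩ := inj _ _ hi₀.2 hS'i.2 hi₀.1 hS'i.1 hS'.symm
    exact perm _ _ hrel

/-- Every circuit of the underlying matroid is the support of an `F`-circuit. -/
theorem exists_mem_circuitSet (φ : WeakGPFunction T E d) {C : Set E}
    (hC : φ.underlying.IsCircuit C) : ∃ X ∈ φ.circuitSet, Tract.supp X = C := by
  have hφ := φ.isSupportedOn
  obtain ⟨e₀, he₀⟩ := hC.nonempty
  obtain ⟨B, hB, hBs⟩ := (hC.sdiff_singleton_indep he₀).exists_isBase_superset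
  have hBc := hφ.ncard_of_isBase φ.ne_zero hB
  obtain ⟨y, hy, hyB⟩ := exists_injective_range_eq hBc
  have hCs : C ⊆ insert e₀ B := fun g hg => by
    by_cases h : g = e₀
    · exact Or.inl h
    · exact Or.inr (hBs ⟨hg, h⟩)
  have he₀B := (hB.mem_of_isCircuit_subset_insert hC hCs).2
  set x : Fin (d + 2) → E := e₀ ∷ y with hx
  have hxi : x.Injective := injective_cons_iff.2 ⟨hyB ▸ he₀B, hy⟩
  have hxr : Set.range x = insert e₀ B := by rw [hx, range_cons_eq_insert, hyB]
  have hk : ∀ k : Fin (d + 2), φ.toFun (x ∘ k.succAbove) ≠ 0 ↔ x k ∈ C := by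
    intro k
    rw [hφ.ne_zero_iff, range_comp_succAbove hxi, hxr, hB.isBase_insert_sdiff_iff hC hCs
      (hxr ▸ Set.mem_range_self k)]
    exact and_iff_right (hxi.comp Fin.succAbove_right_injective)
  -- Cramer's rule: the signed maximal minors of `x` give the dependency among its entries.
  set X : E → WithZero G := Function.extend x
    (fun k => T.negOne ^ (k : ℕ) * φ.toFun (x ∘ k.succAbove)) 0 with hXdef
  have hXx : ∀ k, X (x k) = T.negOne ^ (k : ℕ) * φ.toFun (x ∘ k.succAbove) := fun k =>
    hxi.extend_apply _ _ k
  have hXs : Tract.supp X = C := by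
    ext g
    by_cases hg : g ∈ Set.range x
    · obtain ⟨k, rfl⟩ := hg
      rw [← hk]
      change X (x k) ≠ 0 ↔ _
      rw [hXx, mul_ne_zero_iff, and_iff_right (pow_ne_zero _ T.negOne_ne_zero)]
    · have h1 : X g = 0 := Function.extend_apply' _ _ _ hg
      exact iff_of_false (fun h => h h1) fun h => hg (hxr ▸ hCs h)
  have hrel₀ : ∀ (e f : E) (S : Fin d → E), (e ∷ f ∷ S : Fin (d + 2) → E).Injective →
      Set.range (e ∷ f ∷ S : Fin (d + 2) → E) = Set.range x →
      X e * φ.toFun (e ∷ S) = T.negOne * (X f * φ.toFun (f ∷ S)) := by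
    intro e f S hi hr
    obtain ⟨σ, hσ⟩ := exists_perm_of_range_eq hxi hi hr.symm
    have h0 := hφ.signed_succAbove x σ 0
    have h1 := hφ.signed_succAbove x σ 1
    have e0 : x (σ 0) = e := (congrFun hσ 0).symm
    have e1 : x (σ 1) = f := (congrFun hσ 1).symm
    have t0 : (e ∷ f ∷ S : Fin (d + 2) → E) ∘ Fin.succAbove 0 = f ∷ S := by funext i; simp
    rw [← hXx, ← Function.comp_assoc, ← hσ, e0, t0] at h0
    rw [← hXx, ← Function.comp_assoc, ← hσ, e1, cons_cons_comp_succAbove_one] at h1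
    rw [Fin.val_zero, pow_zero, one_mul] at h0
    rw [Fin.val_one, pow_one] at h1
    have hs := T.signHom_mul_self σ.sign
    generalize T.signHom σ.sign = s at h0 h1 hs
    have hXe : X e = s * φ.toFun (f ∷ S) := by rw [h0, ← mul_assoc, hs, one_mul]
    have hXf : X f = s * (T.negOne * φ.toFun (e ∷ S)) := by rw [h1, ← mul_assoc, hs, one_mul]
    rw [hXe, hXf, mul_left_comm s, mul_assoc T.negOne, T.negOne_mul_cancel_left]
    simp only [mul_comm, mul_left_comm, mul_assoc]
  have main : ∀ (e f : E) (S : Fin d → E), C ⊆ insert e (insert f (Set.range S)) → e ∈ C →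
      f ∈ C → e ≠ f → φ.toFun (f ∷ S) ≠ 0 →
      X e * φ.toFun (e ∷ S) = T.negOne * (X f * φ.toFun (f ∷ S)) := by
    intro e f S hS he hf hef hne
    have hex : e ∈ Set.range x := hxr ▸ hCs he
    have hfx : f ∈ Set.range x \ {e} := ⟨hxr ▸ hCs hf, hef.symm⟩
    -- `S₀` completes `e, f` to a reordering of `x`, where the relation is known; it is transferred
    -- from there to `S`.
    obtain ⟨S₀, hS₀, hS₀r⟩ := exists_injective_range_eq (n := d)
      (S := (Set.range x \ {e}) \ {f}) (by
        rw [Set.ncard_sdiff_singleton_of_mem hfx, Set.ncard_sdiff_singleton_of_mem hex,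
          ncard_range_of_injective hxi]; rfl)
    have hr1 : Set.range (f ∷ S₀ : Fin (d + 1) → E) = Set.range x \ {e} := by
      rw [range_cons_eq_insert, hS₀r, Set.insert_sdiff_singleton, Set.insert_eq_of_mem hfx]
    have hr2 : Set.range (e ∷ f ∷ S₀ : Fin (d + 2) → E) = Set.range x := by
      rw [range_cons_eq_insert, hr1, Set.insert_sdiff_singleton, Set.insert_eq_of_mem hex]
    have hi1 : (f ∷ S₀ : Fin (d + 1) → E).Injective :=
      injective_cons_iff.2 ⟨by rw [hS₀r]; simp, hS₀⟩
    refine φ.circuitRelation_transfer hC hf hef (S₀ := S₀) ?_ hS ?_ hne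
      (hrel₀ e f S₀ (injective_cons_iff.2 ⟨by rw [hr1]; simp, hi1⟩) hr2)
    · rw [← range_cons_eq_insert, ← range_cons_eq_insert, hr2, hxr]
      exact hCs
    · rw [hφ.ne_zero_iff, hr1, hxr, hB.isBase_insert_sdiff_iff hC hCs (hCs he)]
      exact ⟨hi1, he⟩
  have hzero : ∀ g, g ∉ C → X g = 0 := fun g hg => by
    by_contra h
    exact hg (hXs ▸ (show g ∈ Tract.supp X from h))
  refine ⟨X, (φ.mem_circuitSet_iff X).2 ⟨hXs.symm ▸ hC, fun e f S hS => ?_⟩, hXs⟩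
  rw [hXs] at hS
  by_cases he : e ∈ C
  · by_cases hf : f ∈ C
    · by_cases hef : e = f
      · subst hef
        rw [hφ.eq_zero_of_subset hC (x := e ∷ S) (by
          rw [range_cons_eq_insert]; simpa using hS)]
        simp
      · by_cases h1 : φ.toFun (f ∷ S) = 0
        · by_cases h2 : φ.toFun (e ∷ S) = 0
          · rw [h1, h2]; simp
          · rw [← T.eq_negOne_mul_comm]
            exact main f e S (Set.insert_comm e f _ ▸ hS) hf he (Ne.symm hef) h2
        · exact main e f S hS he hf hef h1
    · rw [hzero f hf, hφ.eq_zero_of_subset hC (x := e ∷ S)]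
      · simp
      · rw [range_cons_eq_insert]
        rw [Set.insert_comm] at hS
        exact (Set.subset_insert_iff_of_notMem hf).1 hS
  · rw [hzero e he, hφ.eq_zero_of_subset hC (x := f ∷ S)]
    · simp
    · rw [range_cons_eq_insert]
      exact (Set.subset_insert_iff_of_notMem he).1 hS

theorem supp_image_circuitSet (φ : WeakGPFunction T E d) :
    Tract.supp '' φ.circuitSet = {C | φ.underlying.IsCircuit C} := by
  ext C
  constructor
  · rintro ⟨X, hX, rfl⟩; exact hX.1
  · intro hC
    obtain ⟨X, hX, rfl⟩ := φ.exists_mem_circuitSet hC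
    exact ⟨X, hX, rfl⟩

end WeakGPFunction

/-! ### Elimination at one coordinate as a three-term relation. -/

namespace Tract.IsAlternating

variable {G : Type*} [CommGroup G] {T : Tract G} {E : Type*} {n : ℕ}
  {f : (Fin (n + 2) → E) → WithZero G}

/-- If three vectors `X`, `Y`, `Z` satisfy the circuit relations of `f` that are used in the
elimination of `e` from `X` and `Y`, then the elimination property at `g` amounts to a three-term
Grassmann–Plücker relation. -/
theorem elimination_iff_threeTerm (hf : T.IsAlternating f) {X Y Z : E → WithZero G}
    {U : Fin n → E} {a b e g : E}
    (hge : f (g ∷ e ∷ U) ≠ 0) (hgb : f (g ∷ b ∷ U) ≠ 0)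
    (hXY : X e = T.negOne * Y e) (hXZ : Z a = X a) (hXa : X a ≠ 0)
    (h1 : X g * f (g ∷ e ∷ U) = T.negOne * (X a * f (a ∷ e ∷ U)))
    (h2 : Y g * f (g ∷ e ∷ U) = T.negOne * (Y b * f (b ∷ e ∷ U)))
    (h3 : Z g * f (g ∷ b ∷ U) = T.negOne * (Z a * f (a ∷ b ∷ U)))
    (h4 : X a * f (a ∷ g ∷ U) = T.negOne * (X e * f (e ∷ g ∷ U)))
    (h5 : Y b * f (b ∷ g ∷ U) = T.negOne * (Y e * f (e ∷ g ∷ U))) :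
    formal (X g) + formal (Y g) + formal (T.negOne * Z g) ∈ T.null ↔ T.ThreeTerm f U a e g b := by
  have hε := T.negOne_mul_negOne
  have s1 := hf.cons_swap b g U
  have s2 := hf.cons_swap b e U
  have s3 := hf.cons_swap e g U
  -- Scaling the left sum by `f(g, e, U) f(g, b, U)` and the right one by `-X a` makes them agree
  -- term by term (`e1`, `e2`, `e3`).
  rw [ThreeTerm, ← T.formal_mul_add_mem_null_iff (mul_ne_zero hge hgb) (X g),
    ← T.formal_mul_add_mem_null_iff (mul_ne_zero T.negOne_ne_zero hXa) (f (a ∷ e ∷ U) * _)]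
  rw [hXY, mul_assoc, T.negOne_mul_cancel_left] at h4
  rw [← h4] at h5
  rw [hXZ] at h3
  rw [s2]
  rw [s3] at h1 h2 hge ⊢
  rw [s1] at h3 hgb ⊢
  clear s1 s2 s3
  generalize f (a ∷ e ∷ U) = ae at *
  generalize f (a ∷ g ∷ U) = ag at *
  generalize f (a ∷ b ∷ U) = ab at *
  generalize f (b ∷ e ∷ U) = be at *
  generalize f (b ∷ g ∷ U) = bg at *
  generalize f (e ∷ g ∷ U) = eg at *
  generalize T.negOne = ε at *
  generalize X a = xa at *
  generalize X g = xg at *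
  generalize Y g = yg at *
  generalize Z g = zg at *
  generalize Y b = yb at *
  have e1 : ε * eg * (ε * bg) * xg = ε * xa * (ae * (ε * bg)) := by
    calc _ = xg * (ε * eg) * (ε * bg) := by simp only [mul_comm, mul_left_comm]
      _ = _ := by rw [h1]; simp only [mul_assoc]
  have e2 : ε * eg * (ε * bg) * yg = ε * xa * (ε * (ag * (ε * be))) := by
    calc _ = yg * (ε * eg) * (ε * bg) := by simp only [mul_comm, mul_left_comm]
      _ = yb * bg * (ε * (ε * be)) := by
        rw [h2]; simp only [mul_comm, mul_left_comm]
      _ = _ := by rw [h5]; simp only [mul_comm, mul_left_comm]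
  have e3 : ε * eg * (ε * bg) * (ε * zg) = ε * xa * (eg * ab) := by
    calc _ = zg * (ε * bg) * (ε * ε * eg) := by simp only [mul_comm, mul_left_comm]
      _ = _ := by rw [h3, hε, one_mul]; simp only [mul_comm, mul_left_comm]
  rw [e1, e2, e3]

end Tract.IsAlternating

/-! ### The weak `F`-matroid of a Grassmann–Plücker function, and injectivity. -/

namespace WeakGPFunction

variable {G : Type*} [CommGroup G] {T : Tract G} {E : Type*} {d : ℕ} [Finite E]

theorem modular_elimination (φ : WeakGPFunction T E d) {X Y : E → WithZero G}
    (hX : X ∈ φ.circuitSet) (hY : Y ∈ φ.circuitSet)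
    (hXY : IsModularPair {C | φ.underlying.IsCircuit C} (Tract.supp X) (Tract.supp Y)) {e : E}
    (he : X e = T.neg (Y e)) (hXe : X e ≠ 0) :
    ∃ Z ∈ φ.circuitSet, Z e = 0 ∧ ∀ f : E,
      Tract.formal (X f) + Tract.formal (Y f) + Tract.formal (T.neg (Z f)) ∈ T.null := by
  have hφ := φ.isSupportedOn
  rw [mem_circuitSet_iff] at hX hY
  obtain ⟨hXc, hXr⟩ := hX
  obtain ⟨hYc, hYr⟩ := hY
  rw [Tract.neg] at he
  have hYe : Y e ≠ 0 := by
    intro h; rw [h, mul_zero] at he; exact hXe he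
  obtain ⟨a, haX, haY⟩ := Set.not_subset.1
    fun h => hXY.2.2.1 (hXc.eq_of_subset_isCircuit hYc h)
  obtain ⟨b, hbY, hbX⟩ := Set.not_subset.1
    fun h => hXY.2.2.1 (hYc.eq_of_subset_isCircuit hXc h).symm
  -- Over `B` the supports of `X` and `Y` are the fundamental circuits of `a` and `b`.
  obtain ⟨B, hB, hBs⟩ := (Matroid.indep_of_isModularPair φ.underlying_ground hXY haX haY
    hbY).exists_isBase_superset
  have hea : e ≠ a := by rintro rfl; exact haY hYe
  have heb : e ≠ b := by rintro rfl; exact hbX hXe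
  have hab : a ≠ b := by rintro rfl; exact hbX haX
  have hXB : Tract.supp X ⊆ insert a B := by
    intro g hg
    by_cases hga : g = a
    · exact Or.inl hga
    · refine Or.inr (hBs ⟨Or.inl hg, ?_⟩)
      rintro (h | h)
      · exact hga h
      · exact hbX (h ▸ hg)
  have hYB : Tract.supp Y ⊆ insert b B := by
    intro g hg
    by_cases hgb : g = b
    · exact Or.inl hgb
    · refine Or.inr (hBs ⟨Or.inr hg, ?_⟩)
      rintro (h | h)
      · exact haY (h ▸ hg)
      · exact hgb h
  have hbB := (hB.mem_of_isCircuit_subset_insert hYc hYB).2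
  have heB : e ∈ B := (hXB hXe).resolve_left hea
  have hBc := hφ.ncard_of_isBase φ.ne_zero hB
  obtain ⟨S, hS, hSr⟩ := exists_injective_range_eq (n := d) (S := B \ {e}) (by
    rw [Set.ncard_sdiff_singleton_of_mem heB, hBc]; rfl)
  have heS : insert e (Set.range S) = B := by rw [hSr]; simp [heB]
  have heSi : (e ∷ S : Fin (d + 1) → E).Injective :=
    injective_cons_iff.2 ⟨by rw [hSr]; simp, hS⟩
  have hφe : φ.toFun (e ∷ S) ≠ 0 := by
    rw [hφ.ne_zero_iff, range_cons_eq_insert, heS]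
    exact ⟨heSi, hB⟩
  have hXa : X a ≠ 0 := haX
  have hXae := hXr a e S (heS.symm ▸ hXB)
  have hYbe := hYr b e S (heS.symm ▸ hYB)
  have hφa : φ.toFun (a ∷ S) ≠ 0 := right_ne_zero_of_mul (hXae.symm ▸
    mul_ne_zero T.negOne_ne_zero (mul_ne_zero hXe hφe))
  have hφb : φ.toFun (b ∷ S) ≠ 0 := right_ne_zero_of_mul (hYbe.symm ▸
    mul_ne_zero T.negOne_ne_zero (mul_ne_zero hYe hφe))
  have hBa : φ.underlying.IsBase (insert a (Set.range S)) :=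
    range_cons_eq_insert a S ▸ hφ.isBase hφa
  have hbS : b ∉ insert a (Set.range S) := by
    rintro (h | h)
    · exact hab h.symm
    · exact hbB (hSr ▸ h : b ∈ B \ {e}).1
  -- Eliminating `e` must leave a vector on `S ∪ {a, b}`, which contains only one circuit; as `Y a =
  -- 0`, the scale is forced by `Z a = X a`.
  obtain ⟨Z₀, hZ₀, hZ₀s⟩ := φ.exists_mem_circuitSet
    (hBa.fundCircuit_isCircuit (x := b) (by rw [φ.underlying_ground]; trivial) hbS)
  rw [mem_circuitSet_iff] at hZ₀
  have hZ₀B : Tract.supp Z₀ ⊆ insert b (insert a (Set.range S)) :=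
    hZ₀s ▸ Matroid.fundCircuit_subset_insert _ _ _
  have hZ₀a : Z₀ a ≠ 0 := hφ.apply_right_ne_zero hZ₀.1 hZ₀B hφb
  obtain ⟨α, hα⟩ := WithZero.ne_zero_iff_exists.1 (div_ne_zero hXa hZ₀a)
  obtain ⟨Z, hZ, hZB, hZa⟩ : ∃ Z ∈ φ.circuitSet,
      Tract.supp Z ⊆ insert b (insert a (Set.range S)) ∧ Z a = X a :=
    ⟨_, φ.mul_mem_circuitSet ((φ.mem_circuitSet_iff _).2 hZ₀) α,
      (Tract.supp_mul_left α Z₀).symm ▸ hZ₀B, by simp only [hα, div_mul_cancel₀ _ hZ₀a]⟩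
  have hZr := ((φ.mem_circuitSet_iff _).1 hZ).2
  have hzero : ∀ (W : E → WithZero G) g, g ∉ Tract.supp W → W g = 0 := fun W g h => by
    simpa [Tract.supp] using h
  have hZe : Z e = 0 := hzero Z e fun h => by
    rcases hZB h with h | h | h
    · exact heb h
    · exact hea h
    · exact (hSr ▸ h : e ∈ B \ {e}).2 rfl
  refine ⟨Z, hZ, hZe, fun g => ?_⟩
  rw [Tract.neg]
  by_cases hga : g = a
  · subst hga
    rw [hzero Y g haY, hZa, Tract.formal_zero, add_zero, T.formal_add_mem_null_iff]
  by_cases hgb : g = b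
  · subst hgb
    have hZg : Z g = Y g := by
      apply mul_right_cancel₀ hφb
      rw [hZr g a S hZB, hYbe, hZa, hXae, he, mul_assoc, T.negOne_mul_cancel_left]
    rw [hzero X g hbX, hZg, Tract.formal_zero, zero_add, T.formal_add_mem_null_iff]
  by_cases hge : g = e
  · subst hge
    rw [hZe, mul_zero, Tract.formal_zero, add_zero, T.formal_add_mem_null_iff,
      ← T.eq_negOne_mul_comm]
    exact he
  -- Inside `B` the claim is the three-term relation over `U`, which is `S` without `g`; outside,
  -- all three vectors vanish.
  by_cases hgB : g ∈ B
  · have hgS : g ∈ Set.range S := hSr ▸ ⟨hgB, hge⟩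
    have hcard : (Set.range S \ {g}).ncard + 1 = d := by
      rw [Set.ncard_sdiff_singleton_add_one hgS, ncard_range_of_injective hS]
    obtain _ | m := d
    · omega
    obtain ⟨U, hU, hUr⟩ := exists_injective_range_eq (n := m) (S := Set.range S \ {g}) (by omega)
    have hgU : insert g (Set.range U) = Set.range S := by rw [hUr]; simp [hgS]
    have hgUi : (g ∷ U : Fin (m + 1) → E).Injective :=
      injective_cons_iff.2 ⟨by rw [hUr]; simp, hU⟩
    have hgUr : Set.range (g ∷ U : Fin (m + 1) → E) = Set.range S := by
      rw [range_cons_eq_insert, hgU]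
    have hne : ∀ c, φ.toFun (c ∷ S) ≠ 0 → φ.toFun (g ∷ c ∷ U) ≠ 0 := by
      intro c hc
      rw [hφ.cons_swap c g]
      refine mul_ne_zero T.negOne_ne_zero ?_
      rw [hφ.ne_zero_iff, range_cons_eq_insert, injective_cons_iff] at hc ⊢
      rw [hgUr]
      exact ⟨⟨hc.1.1, hgUi⟩, hc.2⟩
    have perm1 : ∀ c c' : E, insert c (insert c' (Set.range S)) ⊆
        insert g (insert c (Set.range (c' ∷ U : Fin (m + 1) → E))) := by
      intro c c'
      rw [range_cons_eq_insert, ← hgU]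
      intro x; simp only [Set.mem_insert_iff]; tauto
    have perm2 : ∀ c c' : E, insert c (insert c' (Set.range S)) ⊆
        insert c (insert c' (Set.range (g ∷ U : Fin (m + 1) → E))) := fun c c' => by
      rw [hgUr]
    rw [← heS] at hXB hYB
    have hZB' := Set.insert_comm a b _ ▸ hZB
    rw [hφ.elimination_iff_threeTerm (U := U) (a := a) (b := b) (e := e) (hne e hφe) (hne b hφb)
      he hZa hXa (hXr _ _ _ (hXB.trans (perm1 _ _))) (hYr _ _ _ (hYB.trans (perm1 _ _)))
      (hZr _ _ _ (hZB'.trans (perm1 _ _))) (hXr _ _ _ (hXB.trans (perm2 _ _)))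
      (hYr _ _ _ (hYB.trans (perm2 _ _)))]
    exact φ.threeTerm U a e g b
  · rw [hzero X g fun h => (hXB h).elim hga hgB, hzero Y g fun h => (hYB h).elim hgb hgB,
      hzero Z g fun h => (hZB h).elim hgb fun h => h.elim hga fun h =>
        hgB (heS ▸ Set.mem_insert_of_mem _ h)]
    simpa using T.zero_mem

/-- The weak `F`-matroid of a weak Grassmann–Plücker function. -/
def toWeakMatroid (φ : WeakGPFunction T E d) : WeakMatroid T E where
  circuits := φ.circuitSet
  zero_notMem h := by
    obtain ⟨e, he⟩ := h.1.nonempty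
    exact he rfl
  smul_mem X hX α := φ.mul_mem_circuitSet hX α
  incomparable X hX Y hY h := by
    rw [mem_circuitSet_iff] at hX hY
    exact φ.isSupportedOn.exists_eq_mul φ.ne_zero hX.1 (hX.1.eq_of_subset_isCircuit hY.1 h)
      hX.2 hY.2
  modular_elimination X hX Y hY h e he hXe :=
    φ.modular_elimination hX hY (φ.supp_image_circuitSet ▸ h) he hXe

theorem underlying_toWeakMatroid (φ : WeakGPFunction T E d) :
    φ.toWeakMatroid.underlying = φ.underlying := by
  refine Matroid.ext_isCircuit ?_ fun C _ => ?_
  · rw [WeakMatroid.underlying_ground, φ.underlying_ground]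
  · rw [WeakMatroid.underlying_isCircuit]
    exact Set.ext_iff.1 φ.supp_image_circuitSet C

theorem rank_toWeakMatroid (φ : WeakGPFunction T E d) :
    φ.toWeakMatroid.rank = ((d + 1 : ℕ) : ℕ∞) := by
  rw [WeakMatroid.rank, φ.underlying_toWeakMatroid]
  exact φ.exists_matroid.choose_spec.2.1

/-- A weak Grassmann–Plücker function is determined up to equivalence by its `F`-circuits. -/
theorem equiv_of_circuitSet_eq (φ ψ : WeakGPFunction T E d) (h : φ.circuitSet = ψ.circuitSet) :
    φ ≈ ψ := by
  have hM : φ.underlying = ψ.underlying := by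
    rw [← φ.underlying_toWeakMatroid, ← ψ.underlying_toWeakMatroid]
    congr 1
    simp only [toWeakMatroid, h]
  have hφ := φ.isSupportedOn
  have hψ := ψ.isSupportedOn
  rw [← hM] at hψ
  obtain ⟨x₀, hx₀⟩ := φ.ne_zero
  have hψx₀ : ψ.toFun x₀ ≠ 0 := by
    rw [hφ.ne_zero_iff] at hx₀
    rwa [hψ.ne_zero_iff]
  obtain ⟨g, hg⟩ := WithZero.ne_zero_iff_exists.1 (div_ne_zero hx₀ hψx₀)
  have perm : ∀ x y : Fin (d + 1) → E, x.Injective → y.Injective → Set.range x = Set.range y →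
      φ.toFun x = g * ψ.toFun x → φ.toFun y = g * ψ.toFun y := by
    intro x y hx hy hxy h
    obtain ⟨σ, rfl⟩ := exists_perm_of_range_eq hx hy hxy
    rw [hφ.comp_perm, hψ.comp_perm, h, mul_left_comm]
  refine ⟨g, fun x => ?_⟩
  by_cases hx : φ.toFun x = 0
  · have : ψ.toFun x = 0 := by
      by_contra hne
      rw [← ne_eq, hψ.ne_zero_iff, ← hφ.ne_zero_iff] at hne
      exact hne hx
    rw [hx, this, mul_zero]
  · refine Matroid.isBase_induction (M := φ.underlying) (I := ∅) (J := ∅)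
      (P := fun B => ∀ x : Fin (d + 1) → E, Set.range x = B → x.Injective →
        φ.toFun x = g * ψ.toFun x) (hφ.isBase hx₀) (hφ.isBase hx) (Set.empty_subset _)
      (Set.empty_subset _) (Set.disjoint_empty _) (Set.disjoint_empty _) ?_ ?_ x rfl
      ((hφ.ne_zero_iff x).1 hx).1
    · intro S u v hu hv huv hBu hBv _ _ _ hP y hy hyi
      obtain ⟨U, hU, rfl⟩ := exists_injective_range_eq (n := d) (S := S) (by
        have := hφ.ncard_of_isBase φ.ne_zero hBu
        rwa [Set.ncard_insert_of_notMem hu, Nat.add_right_cancel_iff] at this)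
      have hi : ∀ w, w ∉ Set.range U → (w ∷ U : Fin (d + 1) → E).Injective := fun w hw =>
        injective_cons_iff.2 ⟨hw, hU⟩
      refine perm (v ∷ U) y (hi v hv) hyi (by rw [range_cons_eq_insert, hy]) ?_
      have h1 := hP (u ∷ U) (range_cons_eq_insert _ _) (hi u hu)
      -- This common `F`-circuit prescribes the same ratio between the two adjacent bases for `φ`
      -- and for `ψ`.
      obtain ⟨X, hX, hXs⟩ := φ.exists_mem_circuitSet (hBv.fundCircuit_isCircuit (x := u)
        (by rw [φ.underlying_ground]; trivial) (by simp [huv, hu]))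
      have hX' := hX
      rw [h, mem_circuitSet_iff] at hX'
      rw [mem_circuitSet_iff] at hX
      have hsub : Tract.supp X ⊆ insert u (insert v (Set.range U)) :=
        hXs ▸ Matroid.fundCircuit_subset_insert _ _ _
      have hφu : φ.toFun (u ∷ U) ≠ 0 := by
        rw [hφ.ne_zero_iff, range_cons_eq_insert]; exact ⟨hi u hu, hBu⟩
      have hXv : X v ≠ 0 := hφ.apply_right_ne_zero hX.1 hsub hφu
      have r1 := hX.2 u v U hsub
      have r2 := hX'.2 u v U hsub
      apply mul_left_cancel₀ (mul_ne_zero T.negOne_ne_zero hXv)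
      rw [mul_assoc, ← r1, h1, mul_left_comm, r2]
      simp only [mul_left_comm, mul_assoc]
    · intro y hy hyi
      refine perm x₀ y ((hφ.ne_zero_iff _).1 hx₀).1 hyi hy.symm ?_
      rw [hg, div_mul_cancel₀ _ hψx₀]

end WeakGPFunction

/-! ### A reference sign function. -/

namespace Tract

variable {G : Type*} [CommGroup G] (T : Tract G) {E : Type*} {n : ℕ}

/-- The sign of a Vandermonde determinant, after numbering `E`. Dividing by such an `s` turns an
alternating function into a function of sets. -/
theorem exists_isAlternating [Finite E] (n : ℕ) : ∃ s : (Fin n → E) → WithZero G,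
    T.IsAlternating s ∧ ∀ x, x.Injective → s x ≠ 0 := by
  classical
  obtain ⟨N, ⟨ι⟩⟩ := Finite.exists_equiv_fin E
  let v : E → ℤ := fun e => (ι e : ℕ)
  have hv : v.Injective := fun a b h => ι.injective (Fin.ext (by simpa [v] using h))
  let D : (Fin n → E) → ℤ := fun x => (Matrix.vandermonde (v ∘ x)).det
  have hD0 : ∀ x : Fin n → E, D x ≠ 0 ↔ x.Injective := fun x => by
    rw [Matrix.det_vandermonde_ne_zero_iff]
    exact ⟨fun h => h.of_comp, fun h => hv.comp h⟩
  have hDs : ∀ (x : Fin n → E) (i j : Fin n), i ≠ j → D (x ∘ Equiv.swap i j) = - D x := by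
    intro x i j hij
    have := Matrix.det_permute (Equiv.swap i j) (Matrix.vandermonde (v ∘ x))
    rw [Equiv.Perm.sign_swap hij] at this
    exact this.trans (by simp [D])
  refine ⟨fun x => if D x = 0 then 0 else if 0 < D x then 1 else T.negOne, ⟨?_, ?_⟩, ?_⟩
  · intro x i j hij
    simp only [hDs x i j hij]
    rcases lt_trichotomy (D x) 0 with h | h | h
    · simp [h, h.ne, not_lt.2 h.le, T.negOne_mul_negOne]
    · simp [h]
    · simp [h, h.ne', not_lt.2 h.le]
  · intro x hx
    rw [← hD0, not_not] at hx
    simp [hx]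
  · intro x hx
    rw [← hD0] at hx
    simp only [hx, if_false]
    split_ifs
    · exact one_ne_zero
    · exact T.negOne_ne_zero

end Tract

/-! ### Ratios on adjacent bases read off from the `F`-circuits. -/

namespace WeakMatroid

variable {G : Type*} [CommGroup G] {T : Tract G} {E : Type*} [Finite E] (M : WeakMatroid T E)

theorem isCircuit_supp {X : E → WithZero G} (hX : X ∈ M.circuits) :
    M.underlying.IsCircuit (Tract.supp X) :=
  (M.underlying_isCircuit _).2 ⟨X, hX, rfl⟩

theorem supp_image_circuits : Tract.supp '' M.circuits = {C | M.underlying.IsCircuit C} := by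
  ext C; exact (M.underlying_isCircuit C).symm

theorem exists_mem_circuits_of_isBase {B : Set E} {e : E} (hB : M.underlying.IsBase B)
    (he : e ∉ B) : ∃ X ∈ M.circuits, Tract.supp X ⊆ insert e B := by
  obtain ⟨X, hX, hs⟩ := (M.underlying_isCircuit _).1
    (hB.fundCircuit_isCircuit (x := e) (by rw [underlying_ground]; trivial) he)
  exact ⟨X, hX, hs ▸ Matroid.fundCircuit_subset_insert _ _ _⟩

theorem exists_mem_circuits_of_ncard {B D : Set E} (hB : M.underlying.IsBase B)
    (hD : D.ncard = B.ncard) (hDB : ¬ M.underlying.IsBase D) :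
    ∃ X ∈ M.circuits, Tract.supp X ⊆ D := by
  have hi : ¬ M.underlying.Indep D := by
    intro h
    obtain ⟨B', hB', hs⟩ := h.exists_isBase_superset
    have := Set.eq_of_subset_of_ncard_le hs
      (by rw [hD, hB'.ncard_eq_ncard_of_isBase hB]) (Set.toFinite _)
    exact hDB (this ▸ hB')
  rw [Matroid.not_indep_iff (by rw [underlying_ground]; exact Set.subset_univ _)] at hi
  obtain ⟨C, hC, hCc⟩ := hi.exists_isCircuit_subset
  obtain ⟨X, hX, rfl⟩ := (M.underlying_isCircuit _).1 hCc
  exact ⟨X, hX, hC⟩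

theorem apply_ne_zero_of_isBase {B : Set E} {e : E} (hB : M.underlying.IsBase B)
    {X : E → WithZero G} (hX : X ∈ M.circuits) (hs : Tract.supp X ⊆ insert e B) : X e ≠ 0 :=
  (hB.mem_of_isCircuit_subset_insert (M.isCircuit_supp hX) hs).1

/-- Elimination of `e` from the fundamental `F`-circuits of `a` and `b` over a base
`insert e S`. -/
theorem exists_elimination {S : Set E} {a b e : E} (ha : a ∉ S) (hb : b ∉ S) (he : e ∉ S)
    (hab : a ≠ b) (hae : a ≠ e) (hbe : b ≠ e) (hBe : M.underlying.IsBase (insert e S))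
    (hBa : M.underlying.IsBase (insert a S)) (hBb : M.underlying.IsBase (insert b S)) :
    ∃ X ∈ M.circuits, ∃ Y ∈ M.circuits, ∃ Z ∈ M.circuits,
      Tract.supp X ⊆ insert a (insert e S) ∧ Tract.supp Y ⊆ insert b (insert e S) ∧
      Tract.supp Z ⊆ insert a (insert b S) ∧ X e = T.negOne * Y e ∧ Z a = X a ∧ Z b = Y b ∧
      ∀ g, Tract.formal (X g) + Tract.formal (Y g) + Tract.formal (T.negOne * Z g) ∈ T.null := by
  obtain ⟨X, hX, hXs⟩ := M.exists_mem_circuits_of_isBase hBe (e := a) (by simp [*])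
  obtain ⟨Y₀, hY₀, hY₀s⟩ := M.exists_mem_circuits_of_isBase hBe (e := b) (by simp [*])
  have hXe : X e ≠ 0 := M.apply_ne_zero_of_isBase hBa hX (Set.insert_comm a e S ▸ hXs)
  have hY₀e : Y₀ e ≠ 0 := M.apply_ne_zero_of_isBase hBb hY₀ (Set.insert_comm b e S ▸ hY₀s)
  obtain ⟨α, hα⟩ := WithZero.ne_zero_iff_exists.1
    (div_ne_zero (mul_ne_zero T.negOne_ne_zero hXe) hY₀e)
  obtain ⟨Y, hY, hYs, hYe⟩ : ∃ Y ∈ M.circuits, Tract.supp Y ⊆ insert b (insert e S) ∧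
      X e = T.negOne * Y e :=
    ⟨_, M.smul_mem Y₀ hY₀ α, (Tract.supp_mul_left α Y₀).symm ▸ hY₀s, by
      rw [T.eq_negOne_mul_comm]; simp only [hα, div_mul_cancel₀ _ hY₀e]⟩
  -- Fundamental circuits of distinct elements over one base form a modular pair, so (C3)' applies.
  obtain ⟨Z, hZ, hZe, hn⟩ := M.modular_elimination X hX Y hY (by
    rw [supp_image_circuits]
    exact hBe.isModularPair hab (M.isCircuit_supp hX) (M.isCircuit_supp hY) hXs hYs) e hYe hXe
  have hX0 : ∀ g, g ∉ insert a (insert e S) → X g = 0 := fun g hg => by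
    by_contra h; exact hg (hXs h)
  have hY0 : ∀ g, g ∉ insert b (insert e S) → Y g = 0 := fun g hg => by
    by_contra h; exact hg (hYs h)
  refine ⟨X, hX, Y, hY, Z, hZ, hXs, hYs, fun g hg => ?_, hYe, ?_, ?_, hn⟩
  · by_contra hgs
    simp only [Set.mem_insert_iff, not_or] at hgs
    have hge : g ≠ e := by rintro rfl; exact hg hZe
    have h := hn g
    rw [hX0 g (by simp [*]), hY0 g (by simp [*]), Tract.formal_zero, zero_add, zero_add] at h
    exact formal_notMem_null T (mul_ne_zero T.negOne_ne_zero hg) h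
  -- `Y` vanishes at `a`, and a two-term null sum forces equality; the same happens at `b`, where
  -- `X` vanishes.
  · have h := hn a
    rw [hY0 a (by simp [*]), Tract.formal_zero, add_zero, Tract.formal_add_mem_null_iff,
      Tract.neg] at h
    exact mul_left_cancel₀ T.negOne_ne_zero h
  · have h := hn b
    rw [hX0 b (by simp [hab.symm, *]), Tract.formal_zero, zero_add,
      Tract.formal_add_mem_null_iff, Tract.neg] at h
    exact mul_left_cancel₀ T.negOne_ne_zero h

variable {d : ℕ}

/-- Two bases `insert e S` and `insert f S` determine the ratio of the values of a
Grassmann–Plücker function, up to the sign `s`. -/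
theorem exists_ratio {s : (Fin (d + 1) → E) → WithZero G} (hs : T.IsAlternating s)
    (hs0 : ∀ x, x.Injective → s x ≠ 0) {S : Set E} {e f : E} (hcard : S.ncard = d)
    (he : e ∉ S) (hf : f ∉ S)
    (hBe : M.underlying.IsBase (insert e S)) (hBf : M.underlying.IsBase (insert f S)) :
    ∃ r : (WithZero G)ˣ, (e = f → r = 1) ∧ ∀ U : Fin d → E, U.Injective → Set.range U = S →
      ∀ X ∈ M.circuits, Tract.supp X ⊆ insert e (insert f S) →
        X e * s (e ∷ U) * r = T.negOne * (X f * s (f ∷ U)) := by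
  by_cases hef : e = f
  · subst hef
    refine ⟨1, fun _ => rfl, fun U _ _ X hX hXs => ?_⟩
    exact absurd (Set.mem_insert e S) (hBe.mem_of_isCircuit_subset_insert (M.isCircuit_supp hX) hXs).2
  obtain ⟨U₀, hU₀, rfl⟩ := exists_injective_range_eq hcard
  obtain ⟨X₀, hX₀, hX₀s⟩ := M.exists_mem_circuits_of_isBase hBf (e := e) (by simp [*])
  have hX₀e := M.apply_ne_zero_of_isBase hBf hX₀ hX₀s
  have hX₀f := M.apply_ne_zero_of_isBase hBe hX₀ (Set.insert_comm e f _ ▸ hX₀s)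
  have hse := hs0 _ (injective_cons_iff.2 ⟨he, hU₀⟩)
  have hsf := hs0 _ (injective_cons_iff.2 ⟨hf, hU₀⟩)
  -- This does not depend on the choices: reordering `U₀` changes both values of `s` by the same
  -- sign, and `X₀` is unique up to a scalar.
  refine ⟨Units.mk0 (T.negOne * (X₀ f * s (f ∷ U₀)) / (X₀ e * s (e ∷ U₀)))
    (div_ne_zero (mul_ne_zero T.negOne_ne_zero (mul_ne_zero hX₀f hsf)) (mul_ne_zero hX₀e hse)),
    fun h => absurd h hef, fun U hU hUr X hX hXs => ?_⟩
  obtain ⟨τ, rfl⟩ := exists_perm_of_range_eq hU₀ hU hUr.symm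
  obtain ⟨α, rfl⟩ := M.incomparable X hX X₀ hX₀ (hBf.eq_of_isCircuit_subset_insert
    (M.isCircuit_supp hX) (M.isCircuit_supp hX₀) hXs hX₀s).le
  rw [hs.cons_comp_perm, hs.cons_comp_perm, Units.val_mk0, mul_div_assoc',
    div_eq_iff (mul_ne_zero hX₀e hse)]
  simp only [mul_comm, mul_left_comm, mul_assoc]

/-- The ratios determined by the `F`-circuits are a local potential. -/
theorem localPotential {s : (Fin (d + 1) → E) → WithZero G} (hs : T.IsAlternating s)
    (hs0 : ∀ x, x.Injective → s x ≠ 0)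
    (hM : ∀ B, M.underlying.IsBase B → B.ncard = d + 1)
    {w : Set E → E → E → (WithZero G)ˣ}
    (hw1 : ∀ S e, e ∉ S → M.underlying.IsBase (insert e S) → w S e e = 1)
    (hw : ∀ S e f, e ∉ S → f ∉ S → M.underlying.IsBase (insert e S) →
      M.underlying.IsBase (insert f S) → ∀ U : Fin d → E, U.Injective → Set.range U = S →
      ∀ X ∈ M.circuits, Tract.supp X ⊆ insert e (insert f S) →
        X e * s (e ∷ U) * w S e f = T.negOne * (X f * s (f ∷ U))) :
    M.underlying.LocalPotential w where
  cocycle S e f g he hf hg hBe hBf hBg := by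
    by_cases hef : e = f
    · subst hef; rw [hw1 S e he hBe, one_mul]
    by_cases hfg : f = g
    · subst hfg; rw [hw1 S f hf hBf, mul_one]
    have hcard := hM _ hBe
    rw [Set.ncard_insert_of_notMem he, Nat.add_right_cancel_iff] at hcard
    obtain ⟨U, hU, rfl⟩ := exists_injective_range_eq hcard
    have hse := hs0 _ (injective_cons_iff.2 ⟨he, hU⟩)
    by_cases heg : e = g
    · subst heg
      rw [hw1 _ e he hBe, ← Units.val_inj]
      obtain ⟨X, hX, hXs⟩ := M.exists_mem_circuits_of_isBase hBf (e := e) (by simp [*])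
      have hXs' := Set.insert_comm e f _ ▸ hXs
      have hXe := M.apply_ne_zero_of_isBase hBf hX hXs
      have h1 := hw _ e f he hf hBe hBf U hU rfl X hX hXs
      have h2 := hw _ f e hf he hBf hBe U hU rfl X hX hXs'
      apply mul_left_cancel₀ (mul_ne_zero hXe hse)
      rw [Units.val_mul, ← mul_assoc, h1, mul_assoc, h2, T.negOne_mul_cancel_left, Units.val_one,
        mul_one]
    -- Eliminating `f` links the three ratios: `X` gives `e` to `f`, `Y` gives `f` to `g`, and `Z`
    -- gives `e` to `g`.
    · obtain ⟨X, hX, Y, hY, Z, hZ, hXs, hYs, hZs, hXY, hZe, hZg, -⟩ :=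
        M.exists_elimination he hg hf heg hef (Ne.symm hfg) hBf hBe hBg
      have hXe := M.apply_ne_zero_of_isBase hBf hX hXs
      have h1 := hw _ e f he hf hBe hBf U hU rfl X hX hXs
      have h2 := hw _ f g hf hg hBf hBg U hU rfl Y hY (Set.insert_comm g f _ ▸ hYs)
      have h3 := hw _ e g he hg hBe hBg U hU rfl Z hZ hZs
      rw [← Units.val_inj]
      apply mul_left_cancel₀ (mul_ne_zero hXe hse)
      rw [Units.val_mul, ← mul_assoc, h1, hXY, mul_assoc T.negOne (Y f), T.negOne_mul_cancel_left, h2,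
        ← hZe, h3, hZg]
  triangle S a b c ha hb hc hab hac hbc hBab hBac hBbc := by
    have hcard := hM _ hBab
    rw [Set.ncard_insert_of_notMem (by simp [*]), Set.ncard_insert_of_notMem hb,
      Nat.add_right_cancel_iff] at hcard
    obtain _ | m := d
    · omega
    obtain ⟨U, hU, rfl⟩ := exists_injective_range_eq (n := m) (S := S) (by omega)
    -- One circuit in `S + a + b + c` yields all three ratios; its entries cancel, and so do the
    -- signs of `s` and the factors `-1`.
    obtain ⟨X, hX, hXs⟩ := M.exists_mem_circuits_of_isBase hBbc (e := a) (by simp [*])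
    have hi : ∀ p, p ∉ Set.range U → (p ∷ U : Fin (m + 1) → E).Injective := fun p hp =>
      injective_cons_iff.2 ⟨hp, hU⟩
    have hi2 : ∀ p q, p ∉ Set.range U → q ∉ Set.range U → p ≠ q → s (p ∷ q ∷ U) ≠ 0 :=
      fun p q hp hq hpq => hs0 _ (injective_cons_iff.2 ⟨by simp [*], hi q hq⟩)
    have e1 : insert a (insert b (insert c (Set.range U))) ⊆
        insert b (insert c (insert a (Set.range U))) := by
      intro x; simp only [Set.mem_insert_iff]; tauto
    have e2 : insert a (insert b (insert c (Set.range U))) ⊆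
        insert c (insert a (insert b (Set.range U))) := by
      intro x; simp only [Set.mem_insert_iff]; tauto
    have hXa := M.apply_ne_zero_of_isBase hBbc hX hXs
    have hXb := M.apply_ne_zero_of_isBase (Set.insert_comm a c _ ▸ hBac) hX (hXs.trans e1)
    have hXc := M.apply_ne_zero_of_isBase hBab hX (hXs.trans e2)
    have h1 := hw _ b c (by simp [hab.symm, *]) (by simp [hac.symm, *])
      (Set.insert_comm a b _ ▸ hBab) (Set.insert_comm a c _ ▸ hBac) (a ∷ U) (hi a ha)
      (range_cons_eq_insert _ _) X hX (hXs.trans e1)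
    have h2 := hw _ c a (by simp [hbc.symm, *]) (by simp [*])
      (Set.insert_comm b c _ ▸ hBbc) hBab (b ∷ U) (hi b hb)
      (range_cons_eq_insert _ _) X hX (hXs.trans e2)
    have h3 := hw _ a b (by simp [*]) (by simp [*])
      hBac hBbc (c ∷ U) (hi c hc) (range_cons_eq_insert _ _) X hX hXs
    rw [hs.cons_swap a b] at h1
    rw [hs.cons_swap b c] at h2
    rw [hs.cons_swap c a] at h3
    have hε := T.negOne_ne_zero
    have hsab := hi2 a b ha hb hab
    have hsbc := hi2 b c hb hc hbc
    have hsca := hi2 c a hc ha hac.symm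
    rw [mul_comm, ← eq_div_iff (by simp [*])] at h1 h2 h3
    rw [← Units.val_inj, Units.val_mul, Units.val_mul, h1, h2, h3, Units.val_one]
    field_simp
  square S a b c f ha hb hc hf hab hac hbc haf hbf hcf hBab hBac hBfb hBfc hBbc hBaf := by
    have hcard := hM _ hBab
    have hcard2 : ∀ p q, p ∉ S → q ∉ S → p ≠ q → (insert p (insert q S)).ncard = S.ncard + 2 := by
      intro p q hp hq hpq
      rw [Set.ncard_insert_of_notMem (by simp [*]), Set.ncard_insert_of_notMem hq]
    have hcard' := hcard
    rw [hcard2 a b ha hb hab] at hcard'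
    obtain _ | m := d
    · omega
    obtain ⟨U, hU, rfl⟩ := exists_injective_range_eq (n := m) (S := S) (by omega)
    -- The missing diagonals supply circuits `X` in `S + b + c` and `Y` in `S + a + f`; opposite
    -- sides of the square are read off from the same circuit.
    obtain ⟨X, hX, hXs⟩ := M.exists_mem_circuits_of_ncard hBab
      (by rw [hcard2 b c hb hc hbc, hcard2 a b ha hb hab]) hBbc
    obtain ⟨Y, hY, hYs⟩ := M.exists_mem_circuits_of_ncard hBab
      (by rw [hcard2 a f ha hf haf, hcard2 a b ha hb hab]) hBaf
    have hi : ∀ p, p ∉ Set.range U → (p ∷ U : Fin (m + 1) → E).Injective := fun p hp =>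
      injective_cons_iff.2 ⟨hp, hU⟩
    have hi2 : ∀ p q, p ∉ Set.range U → q ∉ Set.range U → p ≠ q → s (p ∷ q ∷ U) ≠ 0 :=
      fun p q hp hq hpq => hs0 _ (injective_cons_iff.2 ⟨by simp [*], hi q hq⟩)
    have sub : ∀ p q r, insert p (insert q (Set.range U)) ⊆
        insert p (insert q (insert r (Set.range U))) := by
      intro p q r x; simp only [Set.mem_insert_iff]; tauto
    have sub' : ∀ p q r, insert q (insert p (Set.range U)) ⊆
        insert p (insert q (insert r (Set.range U))) := by
      intro p q r x; simp only [Set.mem_insert_iff]; tauto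
    have hXb := M.apply_ne_zero_of_isBase (Set.insert_comm a c _ ▸ hBac) hX (hXs.trans (sub b c a))
    have hXc := M.apply_ne_zero_of_isBase (Set.insert_comm a b _ ▸ hBab) hX (hXs.trans (sub' c b a))
    have hYa := M.apply_ne_zero_of_isBase hBfb hY (hYs.trans (sub a f b))
    have hYf := M.apply_ne_zero_of_isBase hBab hY (hYs.trans (sub' f a b))
    have h1 := hw _ a f (by simp [*]) (by simp [hbf.symm, *]) hBab hBfb (b ∷ U) (hi b hb)
      (range_cons_eq_insert _ _) Y hY (hYs.trans (sub a f b))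
    have h2 := hw _ b c (by simp [*]) (by simp [*]) (Set.insert_comm f b _ ▸ hBfb)
      (Set.insert_comm f c _ ▸ hBfc) (f ∷ U) (hi f hf)
      (range_cons_eq_insert _ _) X hX (hXs.trans (sub b c f))
    have h3 := hw _ b c (by simp [hab.symm, *]) (by simp [hac.symm, *])
      (Set.insert_comm a b _ ▸ hBab)
      (Set.insert_comm a c _ ▸ hBac) (a ∷ U) (hi a ha)
      (range_cons_eq_insert _ _) X hX (hXs.trans (sub b c a))
    have h4 := hw _ a f (by simp [*]) (by simp [hcf.symm, *]) hBac hBfc (c ∷ U) (hi c hc)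
      (range_cons_eq_insert _ _) Y hY (hYs.trans (sub a f c))
    rw [hs.cons_swap b f] at h1
    rw [hs.cons_swap a b, hs.cons_swap a c] at h3
    rw [hs.cons_swap c f] at h4
    have hε := T.negOne_ne_zero
    have hsab := hi2 a b ha hb hab
    have hsac := hi2 a c ha hc hac
    have hsbf := hi2 b f hb hf hbf
    have hscf := hi2 c f hc hf hcf
    rw [mul_comm, ← eq_div_iff (by simp [*])] at h1 h2 h3 h4
    rw [← Units.val_inj, Units.val_mul, Units.val_mul, h1, h2, h3, h4]
    field_simp

end WeakMatroid

/-! ### Construction of the Grassmann–Plücker function and its three-term relations. -/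

namespace WeakMatroid

theorem ext_circuits {G : Type*} [CommGroup G] {T : Tract G} {E : Type*} {M N : WeakMatroid T E}
    (h : M.circuits = N.circuits) : M = N := by
  cases M; cases N; cases h; rfl

variable {G : Type*} [CommGroup G] {T : Tract G} {E : Type*} [Finite E] (M : WeakMatroid T E)
  {d : ℕ}

theorem ncard_of_isBase (hr : M.rank = ((d + 1 : ℕ) : ℕ∞)) {B : Set E}
    (hB : M.underlying.IsBase B) : B.ncard = d + 1 := by
  rw [rank, ← hB.encard_eq_eRank] at hr
  rw [Set.ncard_def, hr, ENat.toNat_natCast]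

/-- The `F`-circuits of a weak `F`-matroid satisfy the circuit relations of an alternating function
whose support consists of the bases. -/
theorem exists_isSupportedOn (hr : M.rank = ((d + 1 : ℕ) : ℕ∞)) :
    ∃ f : (Fin (d + 1) → E) → WithZero G, T.IsSupportedOn f M.underlying ∧
      ∀ X ∈ M.circuits, T.CircuitRelation f X := by
  classical
  obtain ⟨s, hs, hs0⟩ := T.exists_isAlternating (E := E) (d + 1)
  have hN : ∀ B, M.underlying.IsBase B → B.ncard = d + 1 := fun B hB => M.ncard_of_isBase hr hB
  have hex : ∀ S e f, ∃ r : (WithZero G)ˣ, e ∉ S → f ∉ S → M.underlying.IsBase (insert e S) →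
      M.underlying.IsBase (insert f S) → (e = f → r = 1) ∧
      ∀ U : Fin d → E, U.Injective → Set.range U = S →
      ∀ X ∈ M.circuits, Tract.supp X ⊆ insert e (insert f S) →
        X e * s (e ∷ U) * r = T.negOne * (X f * s (f ∷ U)) := by
    intro S e f
    by_cases h : e ∉ S ∧ f ∉ S ∧ M.underlying.IsBase (insert e S) ∧
      M.underlying.IsBase (insert f S)
    · obtain ⟨he, hf, hBe, hBf⟩ := h
      have hcard := hN _ hBe
      rw [Set.ncard_insert_of_notMem he, Nat.add_right_cancel_iff] at hcard
      obtain ⟨r, hr⟩ := M.exists_ratio hs hs0 hcard he hf hBe hBf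
      exact ⟨r, fun _ _ _ _ => hr⟩
    · exact ⟨1, fun h1 h2 h3 h4 => absurd ⟨h1, h2, h3, h4⟩ h⟩
  choose w hw using hex
  obtain ⟨ψ, hψ⟩ := (M.localPotential hs hs0 hN (fun S e he hB => (hw S e e he he hB hB).1 rfl)
    (fun S e f he hf hBe hBf => (hw S e f he hf hBe hBf).2)).exists_potential
  let φ : (Fin (d + 1) → E) → WithZero G := fun x =>
    if M.underlying.IsBase (Set.range x) then s x * ψ (Set.range x) else 0
  have hφ : T.IsSupportedOn φ M.underlying := by
    refine ⟨⟨fun x i j hij => ?_, fun x hx => ?_⟩, fun x => ?_⟩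
    · simp only [φ, (Equiv.swap i j).surjective.range_comp]
      split_ifs
      · rw [hs.swap x i j hij, mul_assoc]
      · rw [mul_zero]
    · simp [φ, hs.eq_zero x hx]
    · by_cases hB : M.underlying.IsBase (Set.range x)
      · simp only [φ, hB, if_true, and_true, mul_ne_zero_iff]
        refine ⟨fun h => ?_, fun h => ⟨hs0 x h, Units.ne_zero _⟩⟩
        by_contra hx
        exact h.1 (hs.eq_zero x hx)
      · simp [φ, hB]
  refine ⟨φ, hφ, fun X hX => ?_⟩
  have hXc := M.isCircuit_supp hX
  have main : ∀ (e f : E) (U : Fin d → E), Tract.supp X ⊆ insert e (insert f (Set.range U)) →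
      φ (f ∷ U) ≠ 0 → X e * φ (e ∷ U) = T.negOne * (X f * φ (f ∷ U)) := by
    intro e f U hXs hf0
    have hf := hf0
    rw [hφ.ne_zero_iff, injective_cons_iff, range_cons_eq_insert] at hf
    obtain ⟨⟨hfU, hU⟩, hBf⟩ := hf
    have he := (hBf.mem_of_isCircuit_subset_insert hXc hXs).2
    rw [Set.mem_insert_iff, not_or] at he
    -- If `X f = 0`, the support of `X` lies in `insert e (Set.range U)`, so both sides vanish;
    -- otherwise `e` may replace `f` in the base and the potential applies.
    by_cases hXf : X f = 0
    · rw [hXf, hφ.eq_zero_of_subset hXc (x := e ∷ U)]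
      · simp
      · rw [range_cons_eq_insert]
        rw [Set.insert_comm] at hXs
        exact (Set.subset_insert_iff_of_notMem (show f ∉ Tract.supp X from fun h => h hXf)).1 hXs
    · have hBe : M.underlying.IsBase (insert e (Set.range U)) := by
        have := (hBf.isBase_insert_sdiff_iff hXc hXs (g := f) (by simp)).2 hXf
        rwa [Set.insert_comm, Set.insert_sdiff_self_of_notMem (by simp [Ne.symm he.1, hfU])] at this
      have h1 := (hw _ e f he.2 hfU hBe hBf).2 U hU rfl X hX hXs
      simp only [φ, range_cons_eq_insert, hBe, hBf, if_true]
      rw [hψ _ e f he.2 hfU hBe hBf, Units.val_mul, ← mul_assoc, ← mul_assoc, h1]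
      simp only [mul_assoc]
  intro e f U hXs
  by_cases h1 : φ (f ∷ U) = 0
  · by_cases h2 : φ (e ∷ U) = 0
    · rw [h1, h2]; simp
    · rw [← T.eq_negOne_mul_comm]
      exact main f e U (Set.insert_comm e f _ ▸ hXs) h2
  · exact main e f U hXs h1

variable {M} {f : (Fin (d + 2) → E) → WithZero G}

/-- Outside trivial cases `S ∪ {a, c}` contains a circuit. Its vector gives the same ratio `f(a, p,
S) / f(c, p, S)` for `p = b` and for `p = e`. -/
theorem mul_eq_mul_of_eq_zero (hf : T.IsSupportedOn f M.underlying)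
    (hM : ∀ X ∈ M.circuits, T.CircuitRelation f X) {S : Fin d → E} {a b c e : E}
    (hac : f (a ∷ c ∷ S) = 0) : f (a ∷ b ∷ S) * f (c ∷ e ∷ S) = f (c ∷ b ∷ S) * f (a ∷ e ∷ S) := by
  have main : ∀ a c b e, f (a ∷ c ∷ S) = 0 → f (a ∷ b ∷ S) ≠ 0 → f (c ∷ e ∷ S) ≠ 0 →
      f (a ∷ b ∷ S) * f (c ∷ e ∷ S) = f (c ∷ b ∷ S) * f (a ∷ e ∷ S) := by
    intro a c b e hac hab hce
    by_cases heq : a = c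
    · rw [heq]
    have hBab := hf.isBase hab
    have hi := ((hf.ne_zero_iff _).1 hab).1
    have hi' := ((hf.ne_zero_iff _).1 hce).1
    simp only [injective_cons_iff, range_cons_eq_insert, Set.mem_insert_iff, not_or] at hi hi'
    have hac_inj : (a ∷ c ∷ S : Fin (d + 2) → E).Injective := by
      simp only [injective_cons_iff, range_cons_eq_insert, Set.mem_insert_iff, not_or]
      exact ⟨⟨heq, hi.1.2⟩, hi'.1.2, hi.2.2⟩
    obtain ⟨X, hX, hXs⟩ := M.exists_mem_circuits_of_ncard hBab
      (D := Set.range (a ∷ c ∷ S : Fin (d + 2) → E))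
      (by rw [ncard_range_of_injective hac_inj,
        ncard_range_of_injective ((hf.ne_zero_iff _).1 hab).1])
      (fun h => (hf.ne_zero_iff _).2 ⟨hac_inj, h⟩ hac)
    rw [range_cons_eq_insert, range_cons_eq_insert] at hXs
    have hXs' : ∀ g, Tract.supp X ⊆
        insert a (insert c (Set.range (g ∷ S : Fin (d + 1) → E))) := by
      intro g x hx
      have := hXs hx
      simp only [range_cons_eq_insert, Set.mem_insert_iff] at this ⊢
      tauto
    have hXa : X a ≠ 0 := hf.apply_ne_zero (M.isCircuit_supp hX) (hXs' e) hce
    have hXc : X c ≠ 0 := hf.apply_right_ne_zero (M.isCircuit_supp hX) (hXs' b) hab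
    have r1 := hM X hX a c (b ∷ S) (hXs' b)
    have r2 := hM X hX a c (e ∷ S) (hXs' e)
    apply mul_left_cancel₀ (mul_ne_zero T.negOne_ne_zero (mul_ne_zero hXa hXc))
    calc _ = X a * f (a ∷ b ∷ S) * (T.negOne * (X c * f (c ∷ e ∷ S))) := by
          simp only [mul_comm, mul_left_comm, mul_assoc]
      _ = _ := by rw [r1, ← r2]; simp only [mul_comm, mul_left_comm, mul_assoc]
  by_cases h1 : f (a ∷ b ∷ S) * f (c ∷ e ∷ S) = 0
  · by_cases h2 : f (c ∷ b ∷ S) * f (a ∷ e ∷ S) = 0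
    · rw [h1, h2]
    · refine (main c a b e ?_ (left_ne_zero_of_mul h2) (right_ne_zero_of_mul h2)).symm
      rw [hf.cons_swap a c, hac, mul_zero]
  · exact main a c b e hac (left_ne_zero_of_mul h1) (right_ne_zero_of_mul h1)

theorem threeTerm_of_eq_zero (hf : T.IsSupportedOn f M.underlying)
    (hM : ∀ X ∈ M.circuits, T.CircuitRelation f X) {S : Fin d → E} {a b c e : E}
    (hac : f (a ∷ c ∷ S) = 0) : T.ThreeTerm f S a b c e := by
  rw [Tract.ThreeTerm, hac, zero_mul, mul_zero, Tract.formal_zero, add_zero,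
    Tract.formal_add_mem_null_iff, mul_eq_mul_of_eq_zero hf hM hac, hf.cons_swap c b, mul_assoc]

/-- If `f(p, g, S)` vanishes for some `p` among `a`, `e`, `b`, the relation degenerates to two
terms. Otherwise `a`, `e`, `b` each complete `S + g` to a base; eliminating `e` there and reading
the result at `g` gives the relation. -/
theorem threeTerm (hf : T.IsSupportedOn f M.underlying)
    (hM : ∀ X ∈ M.circuits, T.CircuitRelation f X) (S : Fin d → E) (a e g b : E) :
    T.ThreeTerm f S a e g b := by
  by_cases heq : a = e ∨ a = g ∨ a = b ∨ e = g ∨ e = b ∨ g = b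
  · exact hf.threeTerm_of_eq heq
  by_cases hag : f (a ∷ g ∷ S) = 0
  · exact threeTerm_of_eq_zero hf hM hag
  by_cases heg : f (e ∷ g ∷ S) = 0
  · exact hf.threeTerm_swap_left (threeTerm_of_eq_zero hf hM heg)
  by_cases hgb : f (g ∷ b ∷ S) = 0
  · have hbg : f (b ∷ g ∷ S) = 0 := by rw [hf.cons_swap g b, hgb, mul_zero]
    exact hf.threeTerm_swap_left (hf.threeTerm_swap_middle (hf.threeTerm_swap_right
      (hf.threeTerm_swap_middle (hf.threeTerm_swap_left
        (threeTerm_of_eq_zero hf hM (a := b) (b := e) (c := g) (e := a) hbg)))))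
  simp only [not_or] at heq
  obtain ⟨hae, -, hab, -, heb, -⟩ := heq
  have swap : ∀ {p q : E}, f (p ∷ q ∷ S) ≠ 0 → f (q ∷ p ∷ S) ≠ 0 := fun {p q} h => by
    rw [hf.cons_swap p q]; exact mul_ne_zero T.negOne_ne_zero h
  have base : ∀ {p q : E}, f (p ∷ q ∷ S) ≠ 0 → p ∉ insert q (Set.range S) ∧
      M.underlying.IsBase (insert p (insert q (Set.range S))) := by
    intro p q h
    rw [hf.ne_zero_iff, injective_cons_iff] at h
    simp only [range_cons_eq_insert] at h
    exact ⟨h.1.1, h.2⟩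
  obtain ⟨ha, hBa⟩ := base hag
  obtain ⟨he, hBe⟩ := base heg
  obtain ⟨hb, hBb⟩ := base (swap hgb)
  obtain ⟨X, hX, Y, hY, Z, hZ, hXs, hYs, hZs, hXY, hZa, -, hn⟩ :=
    M.exists_elimination ha hb he hab hae (Ne.symm heb) hBe hBa hBb
  have sub1 : ∀ p q, insert p (insert q (insert g (Set.range S))) ⊆
      insert g (insert p (Set.range (q ∷ S : Fin (d + 1) → E))) := by
    intro p q x
    simp only [range_cons_eq_insert, Set.mem_insert_iff]
    tauto
  have sub2 : ∀ p q, insert p (insert q (insert g (Set.range S))) ⊆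
      insert p (insert q (Set.range (g ∷ S : Fin (d + 1) → E))) := by
    intro p q
    rw [range_cons_eq_insert]
  refine (hf.elimination_iff_threeTerm (swap heg) hgb hXY hZa
    (M.apply_ne_zero_of_isBase hBe hX hXs) (hM X hX _ _ _ (hXs.trans (sub1 _ _)))
    (hM Y hY _ _ _ (hYs.trans (sub1 _ _))) (hM Z hZ _ _ _ (hZs.trans (sub1 _ _)))
    (hM X hX _ _ _ (hXs.trans (sub2 _ _))) (hM Y hY _ _ _ (hYs.trans (sub2 _ _)))).1 (hn g)

end WeakMatroid

/-! ### Surjectivity and the bijection. -/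

namespace WeakMatroid

variable {G : Type*} [CommGroup G] {T : Tract G} {E : Type*} [Finite E] {d : ℕ}

/-- Every weak `F`-matroid arises from a weak Grassmann–Plücker function. -/
theorem exists_toWeakMatroid_eq (M : WeakMatroid T E) (hr : M.rank = ((d + 1 : ℕ) : ℕ∞)) :
    ∃ φ : WeakGPFunction T E d, φ.toWeakMatroid = M := by
  obtain ⟨f, hf, hM⟩ := M.exists_isSupportedOn hr
  have hbase : ∀ B : Set E, M.underlying.IsBase B ↔
      ∃ x : Fin (d + 1) → E, f x ≠ 0 ∧ Set.range x = B := by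
    intro B
    constructor
    · intro hB
      obtain ⟨x, hx, rfl⟩ := exists_injective_range_eq (M.ncard_of_isBase hr hB)
      exact ⟨x, (hf.ne_zero_iff x).2 ⟨hx, hB⟩, rfl⟩
    · rintro ⟨x, hx, rfl⟩
      exact hf.isBase hx
  have hne : ∃ x, f x ≠ 0 := by
    obtain ⟨B, hB⟩ := M.underlying.exists_isBase
    obtain ⟨x, hx, -⟩ := (hbase B).1 hB
    exact ⟨x, hx⟩
  let φ : WeakGPFunction T E d :=
    { toFun := f
      exists_matroid := ⟨M.underlying, M.underlying_ground, hr, hbase⟩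
      ne_zero := hne
      swap := hf.swap
      eq_zero := fun x i j hij h => hf.eq_zero x fun hx => hij (hx h)
      three_term := by
        intro x y hx hy hxy
        -- In rank one `I` has only two elements, so `|I \ J| = 3` is impossible.
        obtain _ | d := d
        · have h1 := Set.ncard_le_ncard (Set.sdiff_subset (s := Set.range x) (t := Set.range y))
          rw [hxy, ncard_range_of_injective hx] at h1
          omega
        · exact hf.pluckerSum_mem_null (threeTerm hf hM) hx hy hxy }
  have hu : φ.underlying = M.underlying := by
    refine Matroid.ext_isBase (by rw [φ.underlying_ground, M.underlying_ground]) fun B _ => ?_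
    rw [φ.underlying_isBase, hbase]
  refine ⟨φ, ext_circuits (Set.Subset.antisymm (fun X hX => ?_) fun X hX => ?_)⟩
  · have hX' := (φ.mem_circuitSet_iff X).1 hX
    rw [hu] at hX'
    obtain ⟨Y, hY, hYX⟩ := (M.underlying_isCircuit _).1 hX'.1
    obtain ⟨α, rfl⟩ := hf.exists_eq_mul hne hX'.1 hYX.symm hX'.2 (hM Y hY)
    exact M.smul_mem Y hY α
  · exact (φ.mem_circuitSet_iff X).2 ⟨hu.symm ▸ M.isCircuit_supp hX, hM X hX⟩

end WeakMatroid

theorem theorem3p9 {G : Type*} [CommGroup G] (T : Tract G) {E : Type*} [Finite E] [Nonempty E]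
    (d : ℕ) :
    ∃ Φ : Quotient (WeakGPFunction.setoid T E d) ≃
        {M : WeakMatroid T E // M.rank = ((d + 1 : ℕ) : ℕ∞)},
      ∀ φ : WeakGPFunction T E d,
        (Φ (Quotient.mk _ φ)).val.circuits = φ.circuitSet ∧
        (Φ (Quotient.mk _ φ)).val.underlying = φ.underlying := by
  let F : Quotient (WeakGPFunction.setoid T E d) →
      {M : WeakMatroid T E // M.rank = ((d + 1 : ℕ) : ℕ∞)} :=
    Quotient.lift (fun φ => ⟨φ.toWeakMatroid, φ.rank_toWeakMatroid⟩) fun φ ψ h =>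
      Subtype.ext (WeakMatroid.ext_circuits (φ.circuitSet_eq_of_equiv ψ h))
  have hF : Function.Bijective F := by
    constructor
    · rintro ⟨φ⟩ ⟨ψ⟩ h
      exact Quotient.sound (φ.equiv_of_circuitSet_eq ψ
        (congrArg (fun M => M.val.circuits) h))
    · rintro ⟨M, hr⟩
      obtain ⟨φ, rfl⟩ := M.exists_toWeakMatroid_eq hr
      exact ⟨Quotient.mk _ φ, rfl⟩
  exact ⟨Equiv.ofBijective F hF, fun φ => ⟨rfl, φ.underlying_toWeakMatroid⟩⟩
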